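/- **Lemma 2 (multi-tenant edge servers).** An edge server is shared by $m\ge 1$ devices. Device $i$ generates requests according to a Poisson process of rate $\lambda_i>0$; at the edge its requests have i.i.d. nonnegative service times of an arbitrary distribution $G_i$ with mean $s_i$ and finite variance; the $m$ arrival processes and all service times are independent. Put $\lambda_{edge}=\sum_i\lambda_i$, let $G=\sum_i\frac{\lambda_i}{\lambda_{edge}}G_i$ be the aggregate service time distribution at the edge, with mean $s_{edge}=\sum_i\frac{\lambda_i}{\lambda_{edge}}s_i>0$, and let $\mu_{edge}^{proc}=1/s_{edge}$. Fix one of the devices, with rate $\lambda_{dev}$ and deterministic service time $s_{dev}>0$, and let $\mu_{dev}^{proc}=1/s_{dev}$. Processors with (real) degrees of parallelism $k_{dev},k_{edge}>0$ are modelled as single servers of aggregated service rates $k_{dev}\mu_{dev}^{proc}$ and $k_{edge}\mu_{edge}^{proc}$; that is, a request with service time $x$ occupies the server of the queue for a time $x/k$. Network payload sizes are $D_{req},D_{res}\ge 0$ and the bandwidth is $B>0$. All queues are first-come-first-served with infinite capacity, and waiting times are steady-state means (limits of the mean waiting time of the $n$-th request). Let - $w_{dev}^{net}$ and $w_{edge}^{net}$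 be the mean waits in the M/M/1 queues at the network interfaces, with arrival rates $\lambda_{dev},\lambda_{edge}$ and service rates $\mu_{dev}^{net},\mu_{edge}^{net}$; - $w_{dev}^{proc}$ be the mean wait in the M/D/1 queue of the device, with arrival rate $\lambda_{dev}$ and service time $1/(k_{dev}\mu_{dev}^{proc})$; - $w_{edge}^{proc}$ be the mean wait in the edge queue fed by the pooled requests of all $m$ devices; and let $$T_{dev}=w_{dev}^{proc}+s_{dev},\qquad T_{edge}=w_{dev}^{net}+\tfrac{D_{req}}{B}+w_{edge}^{proc}+s_{edge}+w_{edge}^{net}+\tfrac{D_{res}}{B}$$ be the mean end-to-end latencies of on-device processing and of edge offloading. Assume stability: $\lambda_{dev}<\mu_{dev}^{net}$, $\lambda_{edge}<\mu_{edge}^{net}$, $\lambda_{edge}<k_{edge}\mu_{edge}^{proc}$, $\lambda_{dev}<k_{dev}\mu_{dev}^{proc}$. Then the pooled arrivals form a Poisson process of rate $\lambda_{edge}$, and the service times along the pooled stream are i.i.d. with distribution $G$ and independent of it, so that the edge is an M/G/1 queue; all the steady-state means above exist and are finite, $s_{edge}$ is the mean service time of a pooled request, and $T_{edge}>T_{dev}$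 if and only if $$s_{dev}-s_{edge}<\frac{\lambda_{dev}}{\mu_{dev}^{net}(\mu_{dev}^{net}-\lambda_{dev})}+\frac{\lambda_{edge}}{\mu_{edge}^{net}(\mu_{edge}^{net}-\lambda_{edge})}+\frac{D_{req}+D_{res}}{B}+\frac{\rho_{edge}+\lambda_{edge}\,k_{edge}\mu_{edge}^{proc}\,\sigma_{edge}^2}{2\,(k_{edge}\mu_{edge}^{proc}-\lambda_{edge})}-\frac12\left(\frac{1}{k_{dev}\mu_{dev}^{proc}-\lambda_{dev}}-\frac{1}{k_{dev}\mu_{dev}^{proc}}\right),$$ where $\rho_{edge}=\lambda_{edge}/(k_{edge}\mu_{edge}^{proc})$ and $\sigma_{edge}^2=\operatorname{Var}[X/k_{edge}]$, $X\sim G$, are the utilization and the service time variance of the M/G/1 edge queue, whose service rate is the aggregated rate $k_{edge}\mu_{edge}^{proc}$. -/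

import Mathlib

open MeasureTheory ProbabilityTheory Filter Topology

noncomputable section

/-- Arrival epochs of a stream that starts at time `0`, from its successive interarrival times. -/
def arrivalEpoch (a : ℕ → ℝ) (n : ℕ) : ℝ := ∑ k ∈ Finset.range (n + 1), a k

/-- Waiting times in an initially empty first-come-first-served single-server queue of infinite
capacity, where request `n` arrives at time `t n` and needs the service time `s n`
(Lindley's recursion). -/
def fcfsWait (t s : ℕ → ℝ) : ℕ → ℝ
  | 0 => 0
  | n + 1 => max 0 (fcfsWait t s n + s n - (t (n + 1) - t n))

/-- The input of an `M/G/1` queue: a Poisson arrival stream of intensity `rate` (i.i.d.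
exponential interarrival times `A`) and, independently of it, i.i.d. service times `S` with
distribution `law`. It is `M/M/1` input if `law` is exponential and `M/D/1` input if `law` is
a Dirac mass. -/
structure IsMG1Input {Ω : Type*} [MeasurableSpace Ω] (P : Measure Ω) (rate : ℝ)
    (law : Measure ℝ) (A S : ℕ → Ω → ℝ) : Prop where
  gap_law : ∀ n, HasLaw (A n) (expMeasure rate) P
  service_law : ∀ n, HasLaw (S n) law P
  indep : iIndepFun (Sum.elim A S : ℕ ⊕ ℕ → Ω → ℝ) P

/-- `m` independent Poisson streams, stream `i` of intensity `rate i`, whose requests have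
independent service requirements, those of stream `i` with distribution `law i`. -/
structure IsTenantInput {Ω : Type*} [MeasurableSpace Ω] (P : Measure Ω) {m : ℕ} (rate : Fin m → ℝ)
    (law : Fin m → Measure ℝ) (A S : Fin m → ℕ → Ω → ℝ) : Prop where
  gap_law : ∀ i n, HasLaw (A i n) (expMeasure (rate i)) P
  service_law : ∀ i n, HasLaw (S i n) (law i) P
  indep : iIndepFun (Sum.elim (fun p => A p.1 p.2) (fun p => S p.1 p.2) :
    (Fin m × ℕ) ⊕ (Fin m × ℕ) → Ω → ℝ) P

/-- The least index at which a finite nonempty family of reals attains its minimum. -/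
def argMin {m : ℕ} [NeZero m] (t : Fin m → ℝ) : Fin m :=
  (Finset.univ.filter fun i => ∀ j, t i ≤ t j).min' (by
    obtain ⟨i, -, hi⟩ := Finset.exists_min_image Finset.univ t Finset.univ_nonempty
    exact ⟨i, by simpa using hi⟩)

/-- Merging `m` streams in order of arrival; `t i k` is the arrival epoch of request `k` of
stream `i`. `mergedCount t n i` is the number of requests of stream `i` among the first `n`
requests of the pooled stream. -/
def mergedCount {m : ℕ} [NeZero m] (t : Fin m → ℕ → ℝ) : ℕ → Fin m → ℕ
  | 0 => fun _ => 0
  | n + 1 =>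
    let c := mergedCount t n
    let j := argMin fun i => t i (c i)
    Function.update c j (c j + 1)

/-- The stream to which request `n` of the pooled stream belongs. -/
def pooledOrigin {m : ℕ} [NeZero m] (t : Fin m → ℕ → ℝ) (n : ℕ) : Fin m :=
  argMin fun i => t i (mergedCount t n i)

/-- The values of a quantity `x i k` attached to the requests, listed along the pooled stream.
With `x = t` these are the pooled arrival epochs. -/
def pooled {m : ℕ} [NeZero m] (t : Fin m → ℕ → ℝ) (x : Fin m → ℕ → ℝ) (n : ℕ) : ℝ :=
  x (pooledOrigin t n) (mergedCount t n (pooledOrigin t n))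

/-- Waiting time of request `n` in the single-server queue with input `A`, `S`. -/
def queueWait {Ω : Type*} (A S : ℕ → Ω → ℝ) (n : ℕ) (ω : Ω) : ℝ :=
  fcfsWait (arrivalEpoch fun k => A k ω) (fun k => S k ω) n

/-- Interarrival times of the stream pooled from the streams with interarrival times `A i`. -/
def sharedGap {Ω : Type*} {m : ℕ} [NeZero m] (A : Fin m → ℕ → Ω → ℝ) (n : ℕ) (ω : Ω) : ℝ :=
  let t : Fin m → ℕ → ℝ := fun i => arrivalEpoch fun k => A i k ω
  match n with
  | 0 => pooled t t 0
  | n + 1 => pooled t t (n + 1) - pooled t t n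

/-- Service requirement of request `n` of the stream pooled from the streams with interarrival
times `A i` and service requirements `S i`. -/
def sharedService {Ω : Type*} {m : ℕ} [NeZero m] (A S : Fin m → ℕ → Ω → ℝ) (n : ℕ) (ω : Ω) : ℝ :=
  pooled (fun i => arrivalEpoch fun k => A i k ω) (fun i k => S i k ω) n

/-- Waiting time of request `n` of the pooled stream in a single-server queue that works at
speed `speed`, so that a service requirement `x` occupies the server for a time `x / speed`. -/
def sharedWait {Ω : Type*} {m : ℕ} [NeZero m] (speed : ℝ) (A S : Fin m → ℕ → Ω → ℝ)
    (n : ℕ) (ω : Ω) : ℝ :=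
  fcfsWait
    (pooled (fun i => arrivalEpoch fun k => A i k ω) (fun i => arrivalEpoch fun k => A i k ω))
    (fun k => sharedService A S k ω / speed) n

/-- `x` is the steady-state mean of the sequence `X` (request `n` contributes `X n`). -/
def IsSteadyStateMean {Ω : Type*} [MeasurableSpace Ω] (P : Measure Ω) (X : ℕ → Ω → ℝ)
    (x : ℝ) : Prop :=
  (∀ n, Integrable (X n) P) ∧ Tendsto (fun n => ∫ ω, X n ω ∂P) atTop (𝓝 x)

/-- The aggregate distribution of the service requirements of several streams: the mixture of the
individual distributions, weighted by the shares of the streams in the total intensity. -/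
def aggregateLaw {m : ℕ} (rate : Fin m → ℝ) (law : Fin m → Measure ℝ) : Measure ℝ :=
  ∑ i, ENNReal.ofReal (rate i / ∑ j, rate j) • law i

end

/-! Once the four mean waits are known, the criterion is a linear rearrangement of `TDev < TEdge`.
Two facts supply the waits: superposition of marked Poisson streams and the Pollaczek–Khinchine
formula.

Superposition. A marked Poisson stream is an i.i.d. sequence of (gap, mark) pairs, and `π` denotes
the product law of the `m` streams. Given that stream `j` arrives first, at time `u`, the other
streams are silent up to `u`; by memorylessness their remainders after `u` are fresh. Hence
splitting off the first arrival maps `π` to `(Exp(∑ λ) ⊗ G) ⊗ π`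
(`map_firstArrival_residualStreams`). Iterating a step of this kind yields i.i.d. innovations
(`map_iterate_eq_infinitePi`). A pathwise shift identity for the merge shows that these innovations
are the pooled gaps and services.

Pollaczek–Khinchine. Let `W n` be the waits, `S n` the services and `A n` the gaps. Lindley's
recursion and integration by parts against the exponential gap express `E W (n+1) ^ (p+2)` through
`E (W n + S n) ^ (p+2)` and `E W (n+1) ^ (p+1)`. A queue that starts empty has stochastically
increasing waits, so all available moments increase in `n`. For `p = 0`, monotonicity of the second
moment bounds the mean wait by the Pollaczek–Khinchine value. For `p = 1`, a finite third service
moment bounds the second moments of the waits; these then converge, and the limit of the `p = 0`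
recursion is an equality. With only two service moments, truncating the services at `K` gives lower
bounds that tend to the same value as `K → ∞`. -/

/-! ### I.i.d. sequences and infinite product measures -/

theorem measurableSet_box {E : Type*} [MeasurableSpace E] (N : ℕ) {t : ℕ → Set E}
    (ht : ∀ n, MeasurableSet (t n)) : MeasurableSet {x : ℕ → E | ∀ n < N, x n ∈ t n} := by
  have : {x : ℕ → E | ∀ n < N, x n ∈ t n} = ⋂ n, ⋂ (_ : n < N), (fun x => x n) ⁻¹' t n := by
    ext; simp
  rw [this]
  exact MeasurableSet.iInter fun n => MeasurableSet.iInter fun _ => measurable_pi_apply n (ht n)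

/-- Every finite set of indices lies in an initial segment, and the additional coordinates can be
left unconstrained. Initial segments are the form suited to induction on `N`. -/
theorem eq_infinitePi_of_range {X : ℕ → Type*} [∀ n, MeasurableSpace (X n)]
    (μ : ∀ n, Measure (X n)) [∀ n, IsProbabilityMeasure (μ n)] {ν : Measure (∀ n, X n)}
    (h : ∀ (N : ℕ) (t : ∀ n, Set (X n)), (∀ n, MeasurableSet (t n)) →
      ν {x | ∀ n < N, x n ∈ t n} = ∏ n ∈ Finset.range N, μ n (t n)) :
    ν = Measure.infinitePi μ := by
  classical
  refine Measure.eq_infinitePi μ fun s t ht => ?_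
  obtain ⟨N, hN⟩ := s.exists_nat_subset_range
  have hset : (s : Set ℕ).pi t
      = {x | ∀ n < N, x n ∈ (fun n => if n ∈ s then t n else Set.univ) n} := by
    ext x
    simp only [Set.mem_pi, Finset.mem_coe, Set.mem_ofPred_eq]
    refine ⟨fun hx n _ => ?_, fun hx n hn => ?_⟩
    · by_cases hn : n ∈ s <;> simp [hn, hx]
    · simpa [hn] using hx n (Finset.mem_range.1 (hN hn))
  rw [hset, h N _ fun n => by by_cases hn : n ∈ s <;> simp [hn, ht],
    ← Finset.prod_subset hN fun n _ hn => by simp [hn]]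
  exact Finset.prod_congr rfl fun n hn => by simp [hn]

/-- The sequence with first term `p.1` and remaining terms `p.2`. -/
def seqCons {E : Type*} (p : E × (ℕ → E)) : ℕ → E := fun n => Nat.casesOn n p.1 p.2

theorem measurable_seqCons {E : Type*} [MeasurableSpace E] :
    Measurable (seqCons : E × (ℕ → E) → ℕ → E) := by
  refine measurable_pi_lambda _ fun n => ?_
  cases n with
  | zero => exact measurable_fst
  | succ n => exact (measurable_pi_apply n).comp measurable_snd

theorem map_seqCons_infinitePi {E : Type*} [MeasurableSpace E] (ν : Measure E)
    [IsProbabilityMeasure ν] :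
    (ν.prod (Measure.infinitePi fun _ : ℕ => ν)).map seqCons
      = Measure.infinitePi fun _ : ℕ => ν := by
  refine eq_infinitePi_of_range _ fun N t ht => ?_
  rw [Measure.map_apply measurable_seqCons (measurableSet_box N ht)]
  cases N with
  | zero => simp
  | succ N =>
    have : seqCons ⁻¹' {x : ℕ → E | ∀ n < N + 1, x n ∈ t n}
        = t 0 ×ˢ ((Finset.range N : Set ℕ).pi fun n => t (n + 1)) := by
      ext p
      simp only [Set.mem_preimage, Set.mem_ofPred_eq, Set.mem_prod, Set.mem_pi, Finset.coe_range,
        Set.mem_Iio]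
      refine ⟨fun h => ⟨h 0 (by omega), fun n hn => h (n + 1) (by omega)⟩, fun h n hn => ?_⟩
      cases n with
      | zero => exact h.1
      | succ n => exact h.2 n (by omega)
    rw [this, Measure.prod_prod, Measure.infinitePi_pi _ fun n _ => ht (n + 1),
      Finset.prod_range_succ', mul_comm]

/-- Iterating a measure preserving step that splits off an independent innovation of law `ν`
produces an i.i.d. sequence of innovations. -/
theorem map_iterate_eq_infinitePi {X E : Type*} [MeasurableSpace X] [MeasurableSpace E]
    {π : Measure X} [IsProbabilityMeasure π] {ν : Measure E} [IsProbabilityMeasure ν]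
    {F : X → E} {Φ : X → X} (hF : Measurable F) (hΦ : Measurable Φ)
    (h : π.map (fun x => (F x, Φ x)) = ν.prod π) :
    π.map (fun x n => F (Φ^[n] x)) = Measure.infinitePi fun _ : ℕ => ν := by
  have hm : ∀ n, Measurable fun x => F (Φ^[n] x) := fun n => hF.comp (hΦ.iterate n)
  refine eq_infinitePi_of_range _ fun N => ?_
  induction N with
  | zero =>
    intro t ht
    rw [Measure.map_apply (measurable_pi_lambda _ hm) (measurableSet_box _ ht)]
    simp
  | succ N ih =>
    intro t ht
    specialize ih (fun n => t (n + 1)) fun n => ht _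
    rw [Measure.map_apply (measurable_pi_lambda _ hm) (measurableSet_box _ fun n => ht _)] at ih ⊢
    -- Since `Φ^[n+1] x = Φ^[n] (Φ x)`, the conditions after the first concern only `Φ x`, to which
    -- the induction hypothesis applies with shifted sets.
    have : (fun x n => F (Φ^[n] x)) ⁻¹' {x | ∀ n < N + 1, x n ∈ t n}
        = (fun x => (F x, Φ x)) ⁻¹' (t 0 ×ˢ
          ((fun x n => F (Φ^[n] x)) ⁻¹' {x | ∀ n < N, x n ∈ t (n + 1)})) := by
      ext x
      simp only [Set.mem_preimage, Set.mem_ofPred_eq, Set.mem_prod]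
      refine ⟨fun h => ⟨h 0 (by omega), fun n hn => h (n + 1) (by omega)⟩, fun h n hn => ?_⟩
      cases n with
      | zero => exact h.1
      | succ n => exact h.2 n (by omega)
    rw [this, ← Measure.map_apply (hF.prodMk hΦ)
      ((ht 0).prod (measurable_pi_lambda _ hm (measurableSet_box _ fun n => ht _))), h, Measure.prod_prod, ih,
      Finset.prod_range_succ', mul_comm]

/-- Reindexing `ι ⊕ ι` by `ι × Bool` makes currying of infinite products available; each inner
family over `Bool` is then read as a pair. -/
theorem hasLaw_pairs_of_iIndepFun {Ω ι : Type*} [MeasurableSpace Ω] {P : Measure Ω} [Countable ι]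
    {μ ν : ι → Measure ℝ} [∀ i, IsProbabilityMeasure (μ i)] [∀ i, IsProbabilityMeasure (ν i)]
    {X Y : ι → Ω → ℝ} (hX : ∀ i, HasLaw (X i) (μ i) P) (hY : ∀ i, HasLaw (Y i) (ν i) P)
    (h : iIndepFun (Sum.elim X Y) P) :
    HasLaw (fun ω i => (X i ω, Y i ω)) (Measure.infinitePi fun i => (μ i).prod (ν i)) P := by
  let Z : ι × Bool → Ω → ℝ := fun p => bif p.2 then X p.1 else Y p.1
  let κ : ι → Bool → Measure ℝ := fun i b => bif b then μ i else ν i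
  have hκ : ∀ i b, IsProbabilityMeasure (κ i b) := fun i b => by
    cases b <;> simp only [κ, cond_true, cond_false] <;> infer_instance
  have hZ : ∀ p, HasLaw (Z p) (κ p.1 p.2) P := by
    rintro ⟨i, _ | _⟩
    exacts [hY i, hX i]
  let g : ι × Bool → ι ⊕ ι := fun p => bif p.2 then Sum.inl p.1 else Sum.inr p.1
  have hg : Function.Injective g := by
    rintro ⟨i, _ | _⟩ ⟨j, _ | _⟩ hij <;> simp_all [g]
  have hZi : iIndepFun Z P := by
    have : Z = fun p => Sum.elim X Y (g p) := by
      funext ⟨i, b⟩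
      cases b <;> rfl
    rw [this]
    exact h.precomp hg
  have h1 := hZi.hasLaw_infinitePi hZ (aemeasurable_pi_iff.2 fun p => (hZ p).aemeasurable)
  have h2 : HasLaw (MeasurableEquiv.curry ι Bool ℝ)
      (Measure.infinitePi fun i => Measure.infinitePi fun b => κ i b)
      (Measure.infinitePi fun p : ι × Bool => κ p.1 p.2) :=
    ⟨(MeasurableEquiv.measurable _).aemeasurable, Measure.infinitePi_map_curry κ⟩
  have hpair : Measurable fun x : Bool → ℝ => (x true, x false) := by fun_prop
  have h3 : HasLaw (fun (x : ι → Bool → ℝ) i => (x i true, x i false))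
      (Measure.infinitePi fun i => (μ i).prod (ν i))
      (Measure.infinitePi fun i => Measure.infinitePi fun b => κ i b) := by
    refine ⟨by fun_prop, ?_⟩
    rw [Measure.infinitePi_map_pi (f := fun (_ : ι) (x : Bool → ℝ) => (x true, x false))
      _ fun _ => hpair]
    congr with i
    rw [Measure.infinitePi_map_eval_prod (by simp)]
    rfl
  exact h3.comp (h2.comp h1)

/-- Pairing is invertible: the preceding lemma, applied to the coordinates of the product measure
`κ`, gives the law of the pairs, and unpairing by `e` carries it back. -/
theorem iIndepFun_of_hasLaw_pairs {Ω ι : Type*} [MeasurableSpace Ω] {P : Measure Ω}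
    [IsProbabilityMeasure P] [Countable ι]
    {μ ν : ι → Measure ℝ} [∀ i, IsProbabilityMeasure (μ i)] [∀ i, IsProbabilityMeasure (ν i)]
    {X Y : ι → Ω → ℝ}
    (h : HasLaw (fun ω i => (X i ω, Y i ω)) (Measure.infinitePi fun i => (μ i).prod (ν i)) P) :
    (∀ i, HasLaw (X i) (μ i) P) ∧ (∀ i, HasLaw (Y i) (ν i) P) ∧ iIndepFun (Sum.elim X Y) P := by
  have hi : ∀ i, HasLaw (fun ω => (X i ω, Y i ω)) ((μ i).prod (ν i)) P := fun i =>
    HasLaw.comp (Y := fun x : ι → ℝ × ℝ => x i)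
      ⟨(measurable_pi_apply i).aemeasurable, Measure.infinitePi_map_eval _ i⟩ h
  have hX : ∀ i, HasLaw (X i) (μ i) P := fun i =>
    HasLaw.comp (Y := Prod.fst) ⟨by fun_prop, by simp⟩ (hi i)
  have hY : ∀ i, HasLaw (Y i) (ν i) P := fun i =>
    HasLaw.comp (Y := Prod.snd) ⟨by fun_prop, by simp⟩ (hi i)
  refine ⟨hX, hY, ?_⟩
  let κ : ι ⊕ ι → Measure ℝ := Sum.elim μ ν
  have hκ : ∀ s, IsProbabilityMeasure (κ s) := by
    rintro (i | i) <;> simp only [κ, Sum.elim_inl, Sum.elim_inr] <;> infer_instance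
  have hS : ∀ s, HasLaw (Sum.elim X Y s) (κ s) P := by
    rintro (i | i)
    exacts [hX i, hY i]
  rw [iIndepFun_iff_hasLaw_Pi_infinitePi hS (aemeasurable_pi_iff.2 fun s => (hS s).aemeasurable)]
  have hc : HasLaw (fun (x : ι ⊕ ι → ℝ) (i : ι) => (x (.inl i), x (.inr i)))
      (Measure.infinitePi fun i => (μ i).prod (ν i)) (Measure.infinitePi κ) := by
    refine hasLaw_pairs_of_iIndepFun (X := fun i (x : ι ⊕ ι → ℝ) => x (.inl i))
      (Y := fun i (x : ι ⊕ ι → ℝ) => x (.inr i))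
      (fun i => ⟨(measurable_pi_apply _).aemeasurable, Measure.infinitePi_map_eval κ (.inl i)⟩)
      (fun i => ⟨(measurable_pi_apply _).aemeasurable, Measure.infinitePi_map_eval κ (.inr i)⟩) ?_
    have : (Sum.elim (fun i x => x (.inl i)) (fun i x => x (.inr i)) :
        ι ⊕ ι → (ι ⊕ ι → ℝ) → ℝ) = fun s x => x s := by
      funext s x
      cases s <;> rfl
    rw [this]
    exact iIndepFun_infinitePi (X := fun _ x => x) fun _ => measurable_id
  let e : (ι → ℝ × ℝ) → ι ⊕ ι → ℝ := fun x => Sum.elim (fun i => (x i).1) (fun i => (x i).2)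
  have he : Measurable e := by
    refine measurable_pi_lambda _ ?_
    rintro (i | i)
    · exact (measurable_pi_apply i).fst
    · exact (measurable_pi_apply i).snd
  have h4 : HasLaw e (Measure.infinitePi κ) (Measure.infinitePi fun i => (μ i).prod (ν i)) := by
    refine ⟨he.aemeasurable, ?_⟩
    rw [← hc.map_eq, Measure.map_map he (by fun_prop)]
    convert Measure.map_id
    funext x s
    cases s <;> rfl
  convert h4.comp h
  rename_i ω s
  cases s <;> rfl

/-! ### The exponential distribution -/

theorem lintegral_expMeasure (r : ℝ) {f : ℝ → ENNReal} (hf : Measurable f) :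
    ∫⁻ x, f x ∂expMeasure r = ∫⁻ x, exponentialPDF r x * f x := by
  have hm : Measurable (exponentialPDF r) := (measurable_exponentialPDFReal r).ennreal_ofReal
  exact lintegral_withDensity_eq_lintegral_mul _ hm hf

theorem ae_nonneg_expMeasure (r : ℝ) : ∀ᵐ x ∂expMeasure r, 0 ≤ x := by
  have hm : Measurable (exponentialPDF r) := (measurable_exponentialPDFReal r).ennreal_ofReal
  change ∀ᵐ x ∂volume.withDensity (exponentialPDF r), 0 ≤ x
  rw [ae_withDensity_iff hm]
  refine ae_of_all _ fun x hx => ?_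
  by_contra h
  exact hx (exponentialPDF_of_neg (not_le.1 h))

/-- For `x ≥ u` the density factors as `r e^{-rx} = e^{-ru} · r e^{-r(x-u)}`. -/
theorem expMeasure_memoryless {r u : ℝ} (hu : 0 ≤ u) :
    ((expMeasure r).restrict (Set.Ici u)).map (fun x => x - u)
      = ENNReal.ofReal (Real.exp (-(r * u))) • expMeasure r := by
  refine Measure.ext_of_lintegral _ fun f hf => ?_
  rw [lintegral_map hf (by fun_prop), ← lintegral_indicator measurableSet_Ici,
    lintegral_smul_measure, lintegral_expMeasure _ hf,
    lintegral_expMeasure _ (Measurable.indicator (by fun_prop) measurableSet_Ici),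
    ← lintegral_sub_right_eq_self (fun x => exponentialPDF r x * f x) u, smul_eq_mul,
    ← lintegral_const_mul']
  swap; · exact ENNReal.ofReal_ne_top
  refine lintegral_congr fun x => ?_
  by_cases hx : u ≤ x
  · rw [Set.indicator_of_mem (by exact hx), exponentialPDF_of_nonneg (hu.trans hx),
      exponentialPDF_of_nonneg (sub_nonneg.2 hx), ← mul_assoc, ← ENNReal.ofReal_mul
      (Real.exp_pos _).le, mul_left_comm, ← Real.exp_add]
    ring_nf
  · rw [Set.indicator_of_notMem (by exact hx), exponentialPDF_of_neg (x := x - u) (by linarith)]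
    simp

/-- Ties have probability zero. The tie-breaking rule of `argMin` produces both strict and weak
inequalities, which this makes interchangeable. -/
theorem restrict_Ioi_expMeasure (r u : ℝ) :
    (expMeasure r).restrict (Set.Ioi u) = (expMeasure r).restrict (Set.Ici u) := by
  have h : expMeasure r ≪ volume := withDensity_absolutelyContinuous _ _
  exact Measure.restrict_congr_set (h.ae_eq Ioi_ae_eq_Ici)

/-- Here `e^{-qu}` is the probability that competitors of total rate `q` are silent until `u`, and
`r / (r + q)` is the probability of arriving before them. -/
theorem lintegral_expMeasure_mul_exp {r q : ℝ} (hr : 0 < r) (hq : 0 ≤ q) {f : ℝ → ENNReal}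
    (hf : Measurable f) :
    ∫⁻ u, ENNReal.ofReal (Real.exp (-(q * u))) * f u ∂expMeasure r
      = ENNReal.ofReal (r / (r + q)) * ∫⁻ u, f u ∂expMeasure (r + q) := by
  rw [lintegral_expMeasure _ (by fun_prop), lintegral_expMeasure _ hf,
    ← lintegral_const_mul' _ _ ENNReal.ofReal_ne_top]
  refine lintegral_congr fun x => ?_
  by_cases hx : 0 ≤ x
  · rw [exponentialPDF_of_nonneg hx, exponentialPDF_of_nonneg hx, ← mul_assoc, ← mul_assoc,
      ← ENNReal.ofReal_mul (by positivity), ← ENNReal.ofReal_mul (by positivity)]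
    congr 2
    rw [mul_assoc, ← Real.exp_add]
    field_simp
    ring_nf
  · rw [exponentialPDF_of_neg (not_le.1 hx), exponentialPDF_of_neg (not_le.1 hx)]
    simp

theorem integral_expMeasure {r : ℝ} (hr : 0 < r) (f : ℝ → ℝ) :
    ∫ x, f x ∂expMeasure r = ∫ x in Set.Ioi 0, r * Real.exp (-(r * x)) * f x := by
  have hm : Measurable (exponentialPDF r) := (measurable_exponentialPDFReal r).ennreal_ofReal
  change ∫ x, f x ∂volume.withDensity (exponentialPDF r) = _
  rw [integral_withDensity_eq_integral_toReal_smul hm (ae_of_all _ fun _ => ENNReal.ofReal_lt_top),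
    ← integral_Ici_eq_integral_Ioi, ← integral_indicator measurableSet_Ici]
  congr with x
  by_cases hx : 0 ≤ x
  · rw [Set.indicator_of_mem (by exact hx), exponentialPDF_of_nonneg hx,
      ENNReal.toReal_ofReal (by positivity), smul_eq_mul]
  · rw [Set.indicator_of_notMem (by exact hx), exponentialPDF_of_neg (not_le.1 hx)]
    simp

theorem integral_pow_expMeasure {r : ℝ} (hr : 0 < r) (p : ℕ) :
    ∫ x, x ^ p ∂expMeasure r = p.factorial / r ^ p := by
  have h := Real.integral_rpow_mul_exp_neg_mul_Ioi (a := p + 1) (r := r) (by positivity) hr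
  have h2 : ∀ x : ℝ, r * Real.exp (-(r * x)) * x ^ p
      = r * (x ^ ((p + 1 : ℝ) - 1) * Real.exp (-(r * x))) := fun x => by
    rw [add_sub_cancel_right, Real.rpow_natCast]
    ring
  rw [integral_expMeasure hr]
  simp_rw [h2]
  rw [integral_const_mul, h, Real.Gamma_nat_eq_factorial]
  norm_cast
  rw [one_div, inv_pow, pow_succ]
  field_simp

theorem memLp_id_expMeasure {r : ℝ} (hr : 0 < r) : MemLp id 2 (expMeasure r) := by
  have := isProbabilityMeasure_expMeasure hr
  rw [memLp_two_iff_integrable_sq measurable_id.aestronglyMeasurable]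
  -- A non-integrable function has integral `0` by convention, whereas the second moment is `2 / r ^
  -- 2 > 0`.
  by_contra h
  have h2 := integral_pow_expMeasure hr 2
  rw [integral_undef (by simpa using h)] at h2
  have : (0 : ℝ) < Nat.factorial 2 / r ^ 2 := by positivity
  linarith

/-- Integration by parts for the truncated moments `E ((v - A)⁺ ^ p)` of an exponential variable. -/
theorem integral_max_pow_expMeasure {r v : ℝ} (hr : 0 < r) (hv : 0 ≤ v) (p : ℕ) :
    ∫ x, max 0 (v - x) ^ (p + 2) ∂expMeasure r
      = v ^ (p + 2) - (p + 2) / r * ∫ x, max 0 (v - x) ^ (p + 1) ∂expMeasure r := by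
  -- The exponent is at least `1`, so the integrand vanishes beyond `v`.
  have key : ∀ q : ℕ, ∫ x, max 0 (v - x) ^ (q + 1) ∂expMeasure r
      = ∫ x in (0)..v, r * Real.exp (-(r * x)) * (v - x) ^ (q + 1) := fun q => by
    rw [integral_expMeasure hr, intervalIntegral.integral_of_le hv,
      ← integral_indicator measurableSet_Ioi, ← integral_indicator measurableSet_Ioc]
    congr with x
    by_cases h0 : 0 < x
    · rw [Set.indicator_of_mem (by exact h0)]
      by_cases h1 : x ≤ v
      · rw [Set.indicator_of_mem (Set.mem_Ioc.2 ⟨h0, h1⟩), max_eq_right (by linarith)]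
      · rw [Set.indicator_of_notMem fun h => h1 (Set.mem_Ioc.1 h).2, max_eq_left (by linarith)]
        simp
    · rw [Set.indicator_of_notMem (by exact h0), Set.indicator_of_notMem fun h => h0 (Set.mem_Ioc.1 h).1]
  -- The boundary term vanishes at `v` and contributes `v ^ (p + 2)` at `0`.
  have hparts := intervalIntegral.integral_deriv_mul_eq_sub (a := 0) (b := v)
    (u := fun x => -Real.exp (-(r * x))) (u' := fun x => r * Real.exp (-(r * x)))
    (v := fun x => (v - x) ^ (p + 2)) (v' := fun x => (p + 2 : ℕ) * (v - x) ^ (p + 1) * -1)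
    (fun x _ => hasDerivAt_neg_exp_mul_exp)
    (fun x _ => by simpa using! ((hasDerivAt_id x).const_sub v).pow (p + 2))
    (Continuous.intervalIntegrable (by fun_prop) _ _)
    (Continuous.intervalIntegrable (by fun_prop) _ _)
  rw [intervalIntegral.integral_add (Continuous.intervalIntegrable (by fun_prop) _ _)
    (Continuous.intervalIntegrable (by fun_prop) _ _)] at hparts
  have h3 : ∫ x in (0)..v, -Real.exp (-(r * x)) * ((p + 2 : ℕ) * (v - x) ^ (p + 1) * -1)
      = (p + 2) / r * ∫ x in (0)..v, r * Real.exp (-(r * x)) * (v - x) ^ (p + 1) := by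
    rw [← intervalIntegral.integral_const_mul]
    congr with x
    push_cast
    field_simp
  rw [key, key, ← h3, eq_sub_iff_add_eq, hparts]
  simp

/-! ### Merging streams pathwise -/

theorem argMin_spec {m : ℕ} [NeZero m] (t : Fin m → ℝ) (j : Fin m) : t (argMin t) ≤ t j := by
  have h := Finset.min'_mem (Finset.univ.filter fun i => ∀ j, t i ≤ t j) (by
    obtain ⟨i, -, hi⟩ := Finset.exists_min_image Finset.univ t Finset.univ_nonempty
    exact ⟨i, by simpa using hi⟩)
  exact (Finset.mem_filter.1 h).2 j

theorem argMin_le {m : ℕ} [NeZero m] (t : Fin m → ℝ) {i : Fin m} (h : ∀ j, t i ≤ t j) :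
    argMin t ≤ i :=
  Finset.min'_le _ _ (by simpa using h)

/-- Ties go to the least index, so competitors of smaller index must be strictly later. For fixed `t
j` this is a separate condition on each competitor, hence a product event. -/
theorem argMin_eq_iff {m : ℕ} [NeZero m] (t : Fin m → ℝ) (j : Fin m) :
    argMin t = j ↔ ∀ i, i ≠ j → t i ∈ (if i < j then Set.Ioi (t j) else Set.Ici (t j)) := by
  constructor
  · rintro rfl i hi
    split_ifs with hlt
    · by_contra h
      exact absurd (argMin_le t fun k => (not_lt.1 h).trans (argMin_spec t k)) (not_le.2 hlt)
    · exact argMin_spec t i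
  · intro h
    have hj : ∀ i, t j ≤ t i := fun i => by
      rcases eq_or_ne i j with rfl | hi
      · exact le_rfl
      · have := h i hi
        split_ifs at this with hlt
        · exact le_of_lt this
        · exact this
    refine le_antisymm (argMin_le t hj) (not_lt.1 fun hlt => ?_)
    have := h _ hlt.ne
    rw [if_pos hlt] at this
    exact absurd (argMin_spec t j) (not_le.2 this)

theorem argMin_sub_const {m : ℕ} [NeZero m] (t : Fin m → ℝ) (c : ℝ) :
    argMin (fun i => t i - c) = argMin t := by
  simp only [argMin, sub_le_sub_iff_right]

section merge

variable {m : ℕ} [NeZero m] {t t' : Fin m → ℕ → ℝ} {c : ℝ}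

/-- The hypothesis says that `t'` is `t` with its first arrival deleted and the clock set back by
`c`. The merge only compares epochs, so a common shift does not affect it. -/
theorem mergedCount_succ_eq
    (h : ∀ i k, t' i k = t i (k + if i = argMin (fun i => t i 0) then 1 else 0) - c) (n : ℕ)
    (i : Fin m) :
    mergedCount t (n + 1) i
      = mergedCount t' n i + if i = argMin (fun i => t i 0) then 1 else 0 := by
  induction n generalizing i with
  | zero =>
    by_cases hi : i = argMin (fun i => t i 0) <;> simp [mergedCount, hi]
  | succ n ih =>
    have hJ : argMin (fun i => t i (mergedCount t (n + 1) i))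
        = argMin (fun i => t' i (mergedCount t' n i)) := by
      simp_rw [h, ih, argMin_sub_const]
    change Function.update (mergedCount t (n + 1)) (argMin fun i => t i (mergedCount t (n + 1) i))
      (mergedCount t (n + 1) (argMin fun i => t i (mergedCount t (n + 1) i)) + 1) i
      = Function.update (mergedCount t' n) (argMin fun i => t' i (mergedCount t' n i))
        (mergedCount t' n (argMin fun i => t' i (mergedCount t' n i)) + 1) i + _
    rw [hJ]
    by_cases hi : i = argMin (fun i => t' i (mergedCount t' n i))
    · subst hi
      simp only [Function.update_self, ih]
      omega
    · rw [Function.update_of_ne hi, Function.update_of_ne hi, ih]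

theorem pooledOrigin_succ_eq
    (h : ∀ i k, t' i k = t i (k + if i = argMin (fun i => t i 0) then 1 else 0) - c) (n : ℕ) :
    pooledOrigin t (n + 1) = pooledOrigin t' n := by
  simp_rw [pooledOrigin, h, mergedCount_succ_eq h, argMin_sub_const]

/-- The offset `d` is separate from `c`: epochs are shifted by `d = c`, marks by `d = 0`. -/
theorem pooled_succ_eq
    (h : ∀ i k, t' i k = t i (k + if i = argMin (fun i => t i 0) then 1 else 0) - c)
    {x x' : Fin m → ℕ → ℝ} {d : ℝ}
    (hx : ∀ i k, x' i k = x i (k + if i = argMin (fun i => t i 0) then 1 else 0) - d) (n : ℕ) :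
    pooled t x (n + 1) = d + pooled t' x' n := by
  rw [pooled, pooled, pooledOrigin_succ_eq h, mergedCount_succ_eq h, hx]
  ring

end merge

/-! ### Splitting off the first arrival -/

/-- The stream `y` of interarrival times and marks, seen at time `u` before its first arrival. -/
noncomputable def delay (u : ℝ) (y : ℕ → ℝ × ℝ) : ℕ → ℝ × ℝ :=
  seqCons (((y 0).1 - u, (y 0).2), fun k => y (k + 1))

/-- The stream that has the first arrival. -/
noncomputable def firstStream {m : ℕ} [NeZero m] (x : Fin m → ℕ → ℝ × ℝ) : Fin m :=
  argMin fun i => (x i 0).1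

/-- The epoch and the mark of the first arrival. -/
noncomputable def firstArrival {m : ℕ} [NeZero m] (x : Fin m → ℕ → ℝ × ℝ) : ℝ × ℝ := x (firstStream x) 0

/-- The streams as seen from just after the first arrival. -/
noncomputable def residualStreams {m : ℕ} [NeZero m] (x : Fin m → ℕ → ℝ × ℝ) : Fin m → ℕ → ℝ × ℝ := fun i =>
  if i = firstStream x then fun k => x i (k + 1) else delay (firstArrival x).1 (x i)

theorem arrivalEpoch_delay (u : ℝ) (y : ℕ → ℝ × ℝ) (k : ℕ) :
    arrivalEpoch (fun k => (delay u y k).1) k = arrivalEpoch (fun k => (y k).1) k - u := by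
  simp only [arrivalEpoch, Finset.sum_range_succ', delay, seqCons]
  exact (add_sub_assoc _ _ _).symm

theorem arrivalEpoch_residualStreams {m : ℕ} [NeZero m] (x : Fin m → ℕ → ℝ × ℝ) (i : Fin m) (k : ℕ) :
    arrivalEpoch (fun k => (residualStreams x i k).1) k
      = arrivalEpoch (fun k => (x i k).1)
          (k + if i = argMin (fun i => arrivalEpoch (fun k => (x i k).1) 0) then 1 else 0)
        - (firstArrival x).1 := by
  have h0 : argMin (fun i => arrivalEpoch (fun k => (x i k).1) 0) = firstStream x := by
    simp [arrivalEpoch, firstStream]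
  rw [h0]
  by_cases hi : i = firstStream x
  · simp only [residualStreams, if_pos hi, arrivalEpoch]
    rw [Finset.sum_range_succ' _ (k + 1), hi]
    simp [firstArrival]
  · simp only [residualStreams, if_neg hi, arrivalEpoch_delay, add_zero]

/-- The trailing `- 0` matches the offset `d = 0` in `pooled_succ_eq`. -/
theorem mark_residualStreams {m : ℕ} [NeZero m] (x : Fin m → ℕ → ℝ × ℝ) (i : Fin m) (k : ℕ) :
    (residualStreams x i k).2
      = (x i (k + if i = argMin (fun i => arrivalEpoch (fun k => (x i k).1) 0) then 1 else 0)).2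
        - 0 := by
  have h0 : argMin (fun i => arrivalEpoch (fun k => (x i k).1) 0) = firstStream x := by
    simp [arrivalEpoch, firstStream]
  rw [h0]
  by_cases hi : i = firstStream x
  · simp only [residualStreams, if_pos hi, sub_zero]
  · simp only [residualStreams, if_neg hi, add_zero, sub_zero]
    cases k <;> rfl

theorem sharedService_eq_iterate {m : ℕ} [NeZero m] (n : ℕ) (x : Fin m → ℕ → ℝ × ℝ) :
    sharedService (fun i k (x : Fin m → ℕ → ℝ × ℝ) => (x i k).1) (fun i k x => (x i k).2) n x
      = (firstArrival (residualStreams^[n] x)).2 := by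
  induction n generalizing x with
  | zero =>
    simp [sharedService, pooled, pooledOrigin, mergedCount, arrivalEpoch, firstArrival,
      firstStream]
  | succ n ih =>
    rw [Function.iterate_succ_apply, ← ih]
    exact (pooled_succ_eq (arrivalEpoch_residualStreams x) (mark_residualStreams x) n).trans (zero_add _)

theorem sharedGap_eq_iterate {m : ℕ} [NeZero m] (n : ℕ) (x : Fin m → ℕ → ℝ × ℝ) :
    sharedGap (fun i k (x : Fin m → ℕ → ℝ × ℝ) => (x i k).1) n x
      = (firstArrival (residualStreams^[n] x)).1 := by
  have h0 : ∀ x : Fin m → ℕ → ℝ × ℝ, pooled (fun i => arrivalEpoch fun k => (x i k).1)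
      (fun i => arrivalEpoch fun k => (x i k).1) 0 = (firstArrival x).1 := fun x => by
    simp [pooled, pooledOrigin, mergedCount, arrivalEpoch, firstArrival, firstStream]
  induction n generalizing x with
  | zero => exact h0 x
  | succ n ih =>
    rw [Function.iterate_succ_apply, ← ih]
    have hs := pooled_succ_eq (arrivalEpoch_residualStreams x) (arrivalEpoch_residualStreams x)
    -- The gap of index `0` is the first epoch itself rather than a difference, so the gap of index
    -- `1` needs its own case.
    cases n with
    | zero =>
      simp only [sharedGap]
      rw [hs 0, h0, h0]
      ring
    | succ n =>
      simp only [sharedGap]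
      rw [hs (n + 1), hs n]
      ring

theorem measurable_delay : Measurable fun p : ℝ × (ℕ → ℝ × ℝ) => delay p.1 p.2 := by
  refine measurable_seqCons.comp (f := fun p : ℝ × (ℕ → ℝ × ℝ) =>
    (((p.2 0).1 - p.1, (p.2 0).2), fun k => p.2 (k + 1))) ?_
  fun_prop

theorem measurable_firstStream {m : ℕ} [NeZero m] :
    Measurable (firstStream : (Fin m → ℕ → ℝ × ℝ) → Fin m) := by
  refine measurable_to_countable' fun j => ?_
  have : firstStream ⁻¹' {j} = ⋂ i, ⋂ (_ : i ≠ j), {x : Fin m → ℕ → ℝ × ℝ |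
      (x i 0).1 ∈ if i < j then Set.Ioi (x j 0).1 else Set.Ici (x j 0).1} := by
    ext x
    simp only [Set.mem_preimage, Set.mem_singleton_iff, firstStream, argMin_eq_iff, Set.mem_iInter,
      Set.mem_ofPred_eq]
  rw [this]
  refine MeasurableSet.iInter fun i => MeasurableSet.iInter fun _ => ?_
  have hm : ∀ i, Measurable fun x : Fin m → ℕ → ℝ × ℝ => (x i 0).1 := fun i => by fun_prop
  split_ifs
  · exact measurableSet_lt (hm j) (hm i)
  · exact measurableSet_le (hm j) (hm i)

theorem measurable_firstArrival {m : ℕ} [NeZero m] :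
    Measurable (firstArrival : (Fin m → ℕ → ℝ × ℝ) → ℝ × ℝ) := by
  have : Measurable fun p : (Fin m → ℕ → ℝ × ℝ) × Fin m => p.1 p.2 0 :=
    measurable_from_prod_countable_left fun j => by fun_prop
  exact this.comp (measurable_id.prodMk measurable_firstStream)

theorem measurable_residualStreams {m : ℕ} [NeZero m] :
    Measurable (residualStreams : (Fin m → ℕ → ℝ × ℝ) → Fin m → ℕ → ℝ × ℝ) := by
  refine measurable_pi_lambda _ fun i => ?_
  refine Measurable.ite (measurable_firstStream (measurableSet_singleton i) |> fun h => ?_)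
    (by fun_prop) (measurable_delay.comp (measurable_firstArrival.fst.prodMk (by fun_prop)))
  convert h using 1
  ext x
  simp [eq_comm]

theorem residualStreams_of_firstStream_eq {m : ℕ} [NeZero m] {x : Fin m → ℕ → ℝ × ℝ} {j : Fin m}
    (h : firstStream x = j) :
    residualStreams x = fun i => if i = j then fun k => x i (k + 1) else delay (x j 0).1 (x i) := by
  subst h
  rfl

/-! ### Laws of delayed and resampled streams -/

/-- For a fixed value of the fresh variable, the preimage of a box is a box in which only side `j`
has changed. With `c = seqCons` this exposes the first pair of stream `j` as an independent
variable. -/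
theorem map_update_pi {ι E F : Type*} [Fintype ι] [DecidableEq ι] [MeasurableSpace E]
    [MeasurableSpace F]
    (ζ : ι → Measure E) [∀ i, IsProbabilityMeasure (ζ i)] (j : ι) (ρ : Measure F)
    [IsProbabilityMeasure ρ] {c : F × E → E} (hc : Measurable c)
    (h : (ρ.prod (ζ j)).map c = ζ j) :
    (ρ.prod (Measure.pi ζ)).map (fun q => Function.update q.2 j (c (q.1, q.2 j)))
      = Measure.pi ζ := by
  have hm : Measurable fun q : F × (ι → E) => Function.update q.2 j (c (q.1, q.2 j)) := by
    refine measurable_pi_lambda _ fun i => ?_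
    rcases eq_or_ne i j with rfl | hi
    · simp only [Function.update_self]
      fun_prop
    · simp only [Function.update_of_ne hi]
      fun_prop
  refine (Measure.pi_eq fun s hs => ?_).symm
  have hcs : MeasurableSet (c ⁻¹' s j) := hc (hs j)
  have hbox : MeasurableSet ((fun q : F × (ι → E) => Function.update q.2 j (c (q.1, q.2 j))) ⁻¹'
      Set.univ.pi s) := hm (MeasurableSet.univ_pi hs)
  rw [Measure.map_apply hm (MeasurableSet.univ_pi hs), Measure.prod_apply hbox]
  have hslice : ∀ p : F, Measure.pi ζ (Prod.mk p ⁻¹'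
      ((fun q : F × (ι → E) => Function.update q.2 j (c (q.1, q.2 j))) ⁻¹' Set.univ.pi s))
      = ζ j (Prod.mk p ⁻¹' (c ⁻¹' s j)) * ∏ i ∈ Finset.univ.erase j, ζ i (s i) := fun p => by
    have : Prod.mk p ⁻¹' ((fun q : F × (ι → E) => Function.update q.2 j (c (q.1, q.2 j))) ⁻¹'
        Set.univ.pi s) = Set.univ.pi (Function.update s j (Prod.mk p ⁻¹' (c ⁻¹' s j))) := by
      ext y
      simp only [Set.mem_preimage, Set.mem_univ_pi]
      refine forall_congr' fun i => ?_
      rcases eq_or_ne i j with rfl | hi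
      · simp
      · simp [Function.update_of_ne hi]
    rw [this, Measure.pi_pi, ← Finset.mul_prod_erase _ _ (Finset.mem_univ j), Function.update_self]
    congr 1
    refine Finset.prod_congr rfl fun i hi => ?_
    rw [Function.update_of_ne (Finset.ne_of_mem_erase hi)]
  simp_rw [hslice]
  rw [lintegral_mul_const _ (measurable_measure_prodMk_left hcs), ← Measure.prod_apply hcs,
    ← Measure.map_apply hc (hs j), h,
    Finset.mul_prod_erase _ (fun i => ζ i (s i)) (Finset.mem_univ j)]

theorem pi_smul {ι E : Type*} [Fintype ι] [MeasurableSpace E] (ζ : ι → Measure E)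
    [∀ i, IsProbabilityMeasure (ζ i)] (c : ι → ENNReal) (hc : ∀ i, c i ≠ ⊤) :
    Measure.pi (fun i => c i • ζ i) = (∏ i, c i) • Measure.pi ζ := by
  have : ∀ i, IsFiniteMeasure (c i • ζ i) := fun i => Measure.smul_finite _ (hc i)
  refine Measure.pi_eq fun s _ => ?_
  simp [Measure.pi_pi, Finset.prod_mul_distrib]

/-- The law of a Poisson stream of intensity `r` with i.i.d. marks of law `G`. -/
noncomputable def streamLaw (r : ℝ) (G : Measure ℝ) : Measure (ℕ → ℝ × ℝ) :=
  Measure.infinitePi fun _ => (expMeasure r).prod G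

theorem isProbabilityMeasure_streamLaw {r : ℝ} (hr : 0 < r) (G : Measure ℝ)
    [IsProbabilityMeasure G] : IsProbabilityMeasure (streamLaw r G) := by
  have := isProbabilityMeasure_expMeasure hr
  unfold streamLaw
  infer_instance

/-- Only the first gap is conditioned and shortened, so memorylessness of that single gap suffices;
its mark and the later pairs are untouched. -/
theorem map_delay_streamLaw {r u : ℝ} (hr : 0 < r) (hu : 0 ≤ u) (G : Measure ℝ)
    [IsProbabilityMeasure G] {I : Set ℝ} (hI : I = Set.Ioi u ∨ I = Set.Ici u) :
    ((streamLaw r G).restrict {y | (y 0).1 ∈ I}).map (delay u)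
      = ENNReal.ofReal (Real.exp (-(r * u))) • streamLaw r G := by
  have := isProbabilityMeasure_expMeasure hr
  have := isProbabilityMeasure_streamLaw hr G
  have hIm : MeasurableSet I := by
    rcases hI with rfl | rfl
    exacts [measurableSet_Ioi, measurableSet_Ici]
  have hd : Measurable (delay u) := measurable_delay.comp (measurable_const.prodMk measurable_id)
  have hset : MeasurableSet {y : ℕ → ℝ × ℝ | (y 0).1 ∈ I} :=
    (measurable_pi_apply (X := fun _ : ℕ => ℝ × ℝ) 0).fst hIm
  have hcons : (((expMeasure r).prod G).prod (streamLaw r G)).map seqCons = streamLaw r G :=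
    map_seqCons_infinitePi _
  have hexp : ((expMeasure r).restrict I).map (fun x => x - u)
      = ENNReal.ofReal (Real.exp (-(r * u))) • expMeasure r := by
    rw [← expMeasure_memoryless hu]
    rcases hI with rfl | rfl
    · rw [restrict_Ioi_expMeasure]
    · rfl
  have hpre : (seqCons ⁻¹' {y : ℕ → ℝ × ℝ | (y 0).1 ∈ I})
      = (I ×ˢ (Set.univ : Set ℝ)) ×ˢ (Set.univ : Set (ℕ → ℝ × ℝ)) := by
    ext p
    simp [seqCons]
  have hcomp : delay u ∘ seqCons
      = seqCons ∘ Prod.map (Prod.map (fun x : ℝ => x - u) (id : ℝ → ℝ)) id := by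
    funext p n
    cases n <;> rfl
  have hsub : Measurable fun x : ℝ => x - u := by fun_prop
  rw [← hcons, Measure.restrict_map measurable_seqCons hset, Measure.map_map hd measurable_seqCons,
    hpre, hcomp, ← Measure.prod_restrict, ← Measure.prod_restrict, Measure.restrict_univ,
    Measure.restrict_univ, ← Measure.map_map measurable_seqCons
      ((hsub.prodMap measurable_id).prodMap measurable_id),
    ← Measure.map_prod_map _ _ (hsub.prodMap measurable_id) measurable_id,
    ← Measure.map_prod_map _ _ hsub measurable_id, hexp, Measure.map_id, Measure.map_id,
    Measure.prod_smul_left, Measure.prod_smul_left, Measure.map_smul, hcons]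

/-- The event and the map act on each stream separately. Every competitor `i ≠ j` contributes its
survival factor `e^{-λ_i u}`, and the factors multiply. -/
theorem map_delay_pi {m : ℕ} {lam : Fin m → ℝ} (hlam : ∀ i, 0 < lam i)
    (law : Fin m → Measure ℝ) [∀ i, IsProbabilityMeasure (law i)] (j : Fin m) {u : ℝ} (hu : 0 ≤ u) :
    ((Measure.pi fun i => streamLaw (lam i) (law i)).restrict
      {y | ∀ i, i ≠ j → (y i 0).1 ∈ if i < j then Set.Ioi u else Set.Ici u}).map
        (fun y i => if i = j then y i else delay u (y i))
      = ENNReal.ofReal (Real.exp (-((∑ i, lam i - lam j) * u)))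
        • Measure.pi fun i => streamLaw (lam i) (law i) := by
  have _ i := isProbabilityMeasure_streamLaw (hlam i) (law i)
  let D : Fin m → Set (ℕ → ℝ × ℝ) := fun i =>
    if i = j then Set.univ else {y | (y 0).1 ∈ if i < j then Set.Ioi u else Set.Ici u}
  let d : Fin m → (ℕ → ℝ × ℝ) → ℕ → ℝ × ℝ := fun i => if i = j then id else delay u
  let c : Fin m → ENNReal := fun i => if i = j then 1 else ENNReal.ofReal (Real.exp (-(lam i * u)))
  have hc : ∀ i, c i ≠ ⊤ := fun i => by
    simp only [c]
    split_ifs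
    exacts [ENNReal.one_ne_top, ENNReal.ofReal_ne_top]
  have hd : ∀ i, Measurable (d i) := fun i => by
    simp only [d]
    split_ifs
    exacts [measurable_id, measurable_delay.comp (measurable_const.prodMk measurable_id)]
  have hmap : ∀ i, ((streamLaw (lam i) (law i)).restrict (D i)).map (d i)
      = c i • streamLaw (lam i) (law i) := fun i => by
    by_cases hi : i = j
    · simp [D, d, c, hi]
    · simp only [D, d, c, if_neg hi]
      refine map_delay_streamLaw (hlam i) hu (law i) ?_
      split_ifs
      exacts [Or.inl rfl, Or.inr rfl]
  have hD : {y : Fin m → ℕ → ℝ × ℝ |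
      ∀ i, i ≠ j → (y i 0).1 ∈ if i < j then Set.Ioi u else Set.Ici u} = Set.univ.pi D := by
    ext y
    simp only [Set.mem_ofPred_eq, Set.mem_univ_pi, D]
    refine forall_congr' fun i => ?_
    by_cases hi : i = j <;> simp [hi]
  have hfun : (fun (y : Fin m → ℕ → ℝ × ℝ) i => if i = j then y i else delay u (y i))
      = fun y i => d i (y i) := by
    funext y i
    by_cases hi : i = j <;> simp [d, hi]
  have hsf : ∀ i, SigmaFinite (((streamLaw (lam i) (law i)).restrict (D i)).map (d i)) :=
    fun i => by
      rw [hmap]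
      have := Measure.smul_finite (streamLaw (lam i) (law i)) (hc i)
      infer_instance
  rw [hD, hfun, Measure.restrict_pi_pi, Measure.pi_map_pi fun i => (hd i).aemeasurable]
  rw [show (fun i => ((streamLaw (lam i) (law i)).restrict (D i)).map (d i)) = _ from funext hmap,
    pi_smul _ _ hc]
  congr 1
  have hprod : ∏ i, c i = ∏ i ∈ Finset.univ.erase j, ENNReal.ofReal (Real.exp (-(lam i * u))) := by
    rw [← Finset.mul_prod_erase _ _ (Finset.mem_univ j)]
    simp only [c, if_pos, one_mul]
    exact Finset.prod_congr rfl fun i hi => by rw [if_neg (Finset.ne_of_mem_erase hi)]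
  rw [hprod, ← ENNReal.ofReal_prod_of_nonneg fun _ _ => (Real.exp_pos _).le, ← Real.exp_sum,
    Finset.sum_neg_distrib, ← Finset.sum_mul, ← Finset.add_sum_erase _ lam (Finset.mem_univ j),
    add_sub_cancel_left]

/-! ### Superposition of marked Poisson streams -/

theorem isProbabilityMeasure_aggregateLaw {m : ℕ} [NeZero m] {lam : Fin m → ℝ}
    (hlam : ∀ i, 0 < lam i) (law : Fin m → Measure ℝ) [∀ i, IsProbabilityMeasure (law i)] :
    IsProbabilityMeasure (aggregateLaw lam law) := by
  have hpos : 0 < ∑ i, lam i := Finset.sum_pos (fun i _ => hlam i) Finset.univ_nonempty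
  refine ⟨?_⟩
  simp only [aggregateLaw, Measure.coe_finsetSum, Finset.sum_apply, Measure.smul_apply,
    measure_univ, smul_eq_mul, mul_one]
  rw [← ENNReal.ofReal_sum_of_nonneg fun i _ => (div_pos (hlam i) hpos).le, ← Finset.sum_div,
    div_self hpos.ne', ENNReal.ofReal_one]

/-- The first arrival of independent marked Poisson streams is independent of the residual streams,
which have the law of the original ones. -/
theorem map_firstArrival_residualStreams {m : ℕ} [NeZero m] {lam : Fin m → ℝ}
    (hlam : ∀ i, 0 < lam i) (law : Fin m → Measure ℝ) [∀ i, IsProbabilityMeasure (law i)] :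
    (Measure.pi fun i => streamLaw (lam i) (law i)).map
        (fun x => (firstArrival x, residualStreams x))
      = ((expMeasure (∑ i, lam i)).prod (aggregateLaw lam law)).prod
        (Measure.pi fun i => streamLaw (lam i) (law i)) := by
  have _ i := isProbabilityMeasure_streamLaw (hlam i) (law i)
  have _ i := isProbabilityMeasure_expMeasure (hlam i)
  have hpos : 0 < ∑ i, lam i := Finset.sum_pos (fun i _ => hlam i) Finset.univ_nonempty
  have := isProbabilityMeasure_expMeasure hpos
  have := isProbabilityMeasure_aggregateLaw hlam law
  set π := Measure.pi fun i => streamLaw (lam i) (law i) with hπ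
  refine Measure.ext_of_lintegral _ fun f hf => ?_
  have hFR := (measurable_firstArrival (m := m)).prodMk measurable_residualStreams
  rw [lintegral_map hf hFR, lintegral_prod _ hf.aemeasurable]
  set g : ℝ × ℝ → ENNReal := fun p => ∫⁻ y, f (p, y) ∂π with hg_def
  have hg : Measurable g := hf.lintegral_prod_right'
  -- The contribution of the event that stream `j` arrives first; summing over `j` produces the
  -- mixture `aggregateLaw`.
  have hstream : ∀ j, ∫⁻ x in firstStream ⁻¹' {j}, f (firstArrival x, residualStreams x) ∂π
      = ∫⁻ s, ENNReal.ofReal (lam j / ∑ i, lam i) * ∫⁻ u, g (u, s) ∂expMeasure (∑ i, lam i)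
        ∂law j := fun j => by
    -- Stream `j` is written as an independent first pair followed by a fresh stream, so that the
    -- integral over the first arrival can be taken last.
    have hu := map_update_pi (fun i => streamLaw (lam i) (law i)) j
      ((expMeasure (lam j)).prod (law j)) measurable_seqCons (map_seqCons_infinitePi _)
    set U : (ℝ × ℝ) × (Fin m → ℕ → ℝ × ℝ) → Fin m → ℕ → ℝ × ℝ := fun q =>
      Function.update q.2 j (seqCons (q.1, q.2 j)) with hU
    have hUm : Measurable U := by
      refine measurable_pi_lambda _ fun i => ?_
      rcases eq_or_ne i j with rfl | hi
      · simp only [U, Function.update_self]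
        exact measurable_seqCons.comp (by fun_prop)
      · simp only [U, Function.update_of_ne hi]
        fun_prop
    have hJ : MeasurableSet (firstStream ⁻¹' {j} : Set (Fin m → ℕ → ℝ × ℝ)) :=
      measurable_firstStream (measurableSet_singleton j)
    have hUj : ∀ q, U q j 0 = q.1 := fun q => by simp [U, seqCons]
    have hUi : ∀ q i, i ≠ j → U q i = q.2 i := fun q i hi => by simp [U, hi]
    have hfirst : ∀ q, firstStream (U q) = j ↔
        q.2 ∈ {y : Fin m → ℕ → ℝ × ℝ |
          ∀ i, i ≠ j → (y i 0).1 ∈ if i < j then Set.Ioi q.1.1 else Set.Ici q.1.1} := fun q => by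
      rw [firstStream, argMin_eq_iff]
      refine forall_congr' fun i => forall_congr' fun hi => ?_
      rw [hUj, hUi q i hi]
    have hind : Measurable ((firstStream ⁻¹' {j}).indicator
        fun x => f (firstArrival x, residualStreams x)) := (hf.comp hFR).indicator hJ
    have hindU : Measurable fun q => (firstStream ⁻¹' {j}).indicator
        (fun x => f (firstArrival x, residualStreams x)) (U q) := hind.comp hUm
    rw [← lintegral_indicator hJ]
    conv_lhs => rw [hπ, ← hu]
    rw [lintegral_map hind hUm,
      lintegral_prod _ hindU.aemeasurable]
    -- With the first pair `p` of stream `j` fixed, its remainder is already fresh, and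
    -- `map_delay_pi` treats the competitors.
    have hinner : ∀ᵐ p ∂(expMeasure (lam j)).prod (law j),
        ∫⁻ y, (firstStream ⁻¹' {j}).indicator (fun x => f (firstArrival x, residualStreams x))
            (U (p, y)) ∂π
          = ENNReal.ofReal (Real.exp (-((∑ i, lam i - lam j) * p.1))) * g p := by
      have h0 : ∀ᵐ p ∂(expMeasure (lam j)).prod (law j), 0 ≤ p.1 :=
        Measure.quasiMeasurePreserving_fst.ae (ae_nonneg_expMeasure (lam j))
      filter_upwards [h0] with p hp
      have hmd : Measurable fun (y : Fin m → ℕ → ℝ × ℝ) i =>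
          if i = j then y i else delay p.1 (y i) := by
        refine measurable_pi_lambda _ fun i => ?_
        split_ifs
        · fun_prop
        · exact measurable_delay.comp (measurable_const.prodMk (measurable_pi_apply i))
      have hset : MeasurableSet {y : Fin m → ℕ → ℝ × ℝ |
          ∀ i, i ≠ j → (y i 0).1 ∈ if i < j then Set.Ioi p.1 else Set.Ici p.1} := by
        have : {y : Fin m → ℕ → ℝ × ℝ |
            ∀ i, i ≠ j → (y i 0).1 ∈ if i < j then Set.Ioi p.1 else Set.Ici p.1}
            = (fun y => U (p, y)) ⁻¹' (firstStream ⁻¹' {j}) := by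
          ext y
          exact (hfirst (p, y)).symm
        rw [this]
        exact (hUm.comp (measurable_const.prodMk measurable_id)) hJ
      rw [hg_def]
      simp only
      rw [← smul_eq_mul, ← lintegral_smul_measure, hπ, ← map_delay_pi hlam law j hp,
        lintegral_map (f := fun y => f (p, y)) (by fun_prop) hmd,
        ← lintegral_indicator hset]
      refine lintegral_congr fun y => ?_
      by_cases hy : firstStream (U (p, y)) = j
      · rw [Set.indicator_of_mem (by exact hy), Set.indicator_of_mem ((hfirst (p, y)).1 hy),
          residualStreams_of_firstStream_eq hy, firstArrival, hy, hUj]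
        congr 2
        funext i
        by_cases hi : i = j
        · subst hi
          simp [U, seqCons]
        · simp only [if_neg hi, hUi _ i hi]
      · rw [Set.indicator_of_notMem (by exact hy),
          Set.indicator_of_notMem fun h => hy ((hfirst (p, y)).2 h)]
    rw [lintegral_congr_ae hinner, lintegral_prod_symm' _ (by fun_prop)]
    refine lintegral_congr fun s => ?_
    -- The competitors have total rate `q = ∑ λ - λ_j`, so the survival factor turns `Exp(λ_j)` into
    -- the weight `λ_j / ∑ λ` times `Exp(∑ λ)`. The epoch is thus independent of which stream
    -- arrives first.
    have hq : 0 ≤ ∑ i, lam i - lam j := sub_nonneg.2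
      (Finset.single_le_sum (fun i _ => (hlam i).le) (Finset.mem_univ j))
    rw [lintegral_expMeasure_mul_exp (f := fun u => g (u, s)) (hlam j) hq (by fun_prop),
      add_sub_cancel]
  have hsplit : ∫⁻ x, f (firstArrival x, residualStreams x) ∂π
      = ∑ j, ∫⁻ x in firstStream ⁻¹' {j}, f (firstArrival x, residualStreams x) ∂π := by
    have huniv : (⋃ j, firstStream ⁻¹' {j} : Set (Fin m → ℕ → ℝ × ℝ)) = Set.univ := by
      ext x
      simp
    rw [← setLIntegral_univ, ← huniv, lintegral_iUnion
      (fun j => measurable_firstStream (measurableSet_singleton j)) (fun i j hij =>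
        Disjoint.preimage _ (Set.disjoint_singleton.2 hij)), tsum_fintype]
  rw [hsplit, lintegral_prod_symm' _ hg]
  simp_rw [hstream]
  simp only [aggregateLaw, lintegral_finsetSum_measure, lintegral_smul_measure, smul_eq_mul]
  refine Finset.sum_congr rfl fun j _ => ?_
  rw [lintegral_const_mul' _ _ ENNReal.ofReal_ne_top]

/-- Superposition of independent Poisson streams with independent marks: the pooled stream is a
Poisson stream whose marks are i.i.d. with the aggregate law. -/
theorem IsTenantInput.isMG1Input_shared {Ω : Type*} [MeasurableSpace Ω] {P : Measure Ω}
    [IsProbabilityMeasure P] {m : ℕ} [NeZero m] {lam : Fin m → ℝ} (hlam : ∀ i, 0 < lam i)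
    {law : Fin m → Measure ℝ} [∀ i, IsProbabilityMeasure (law i)] {A S : Fin m → ℕ → Ω → ℝ}
    (h : IsTenantInput P lam law A S) :
    IsMG1Input P (∑ i, lam i) (aggregateLaw lam law) (sharedGap A) (sharedService A S) := by
  have _ i := isProbabilityMeasure_streamLaw (hlam i) (law i)
  have _ i := isProbabilityMeasure_expMeasure (hlam i)
  have hpos : 0 < ∑ i, lam i := Finset.sum_pos (fun i _ => hlam i) Finset.univ_nonempty
  have := isProbabilityMeasure_expMeasure hpos
  have := isProbabilityMeasure_aggregateLaw hlam law
  have h1 : HasLaw (fun ω (p : Fin m × ℕ) => (A p.1 p.2 ω, S p.1 p.2 ω))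
      (Measure.infinitePi fun p : Fin m × ℕ => (expMeasure (lam p.1)).prod (law p.1)) P :=
    hasLaw_pairs_of_iIndepFun (fun p => h.gap_law p.1 p.2) (fun p => h.service_law p.1 p.2) h.indep
  have h2 : HasLaw (MeasurableEquiv.curry (Fin m) ℕ (ℝ × ℝ))
      (Measure.pi fun i => streamLaw (lam i) (law i))
      (Measure.infinitePi fun p : Fin m × ℕ => (expMeasure (lam p.1)).prod (law p.1)) := by
    refine ⟨(MeasurableEquiv.measurable _).aemeasurable, ?_⟩
    rw [Measure.infinitePi_map_curry fun i (_ : ℕ) => (expMeasure (lam i)).prod (law i),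
      Measure.infinitePi_eq_pi]
    rfl
  have h3 : HasLaw (fun (x : Fin m → ℕ → ℝ × ℝ) n => firstArrival (residualStreams^[n] x))
      (Measure.infinitePi fun _ : ℕ => (expMeasure (∑ i, lam i)).prod (aggregateLaw lam law))
      (Measure.pi fun i => streamLaw (lam i) (law i)) :=
    ⟨(measurable_pi_lambda _ fun n =>
      measurable_firstArrival.comp (measurable_residualStreams.iterate n)).aemeasurable,
      map_iterate_eq_infinitePi measurable_firstArrival measurable_residualStreams
        (map_firstArrival_residualStreams hlam law)⟩
  have h4 : HasLaw (fun ω n => (sharedGap A n ω, sharedService A S n ω))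
      (Measure.infinitePi fun _ : ℕ => (expMeasure (∑ i, lam i)).prod (aggregateLaw lam law)) P := by
    convert h3.comp (h2.comp h1) using 1
    funext ω n
    exact Prod.ext (sharedGap_eq_iterate n fun i k => (A i k ω, S i k ω))
      (sharedService_eq_iterate n fun i k => (A i k ω, S i k ω))
  obtain ⟨hA, hS, hi⟩ := iIndepFun_of_hasLaw_pairs h4
  exact ⟨hA, hS, hi⟩

/-! ### The shared edge as a single queue -/

theorem arrivalEpoch_sharedGap {Ω : Type*} {m : ℕ} [NeZero m] (A : Fin m → ℕ → Ω → ℝ) (ω : Ω) :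
    arrivalEpoch (fun k => sharedGap A k ω)
      = pooled (fun i => arrivalEpoch fun k => A i k ω) (fun i => arrivalEpoch fun k => A i k ω) := by
  funext n
  induction n with
  | zero => simp [arrivalEpoch, sharedGap]
  | succ n ih =>
    rw [arrivalEpoch, Finset.sum_range_succ, ← arrivalEpoch, ih]
    simp only [sharedGap]
    ring

theorem sharedWait_eq_queueWait {Ω : Type*} {m : ℕ} [NeZero m] (speed : ℝ)
    (A S : Fin m → ℕ → Ω → ℝ) :
    sharedWait speed A S
      = queueWait (sharedGap A) fun n ω => sharedService A S n ω / speed := by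
  funext n ω
  simp only [sharedWait, queueWait, arrivalEpoch_sharedGap]

/-- Used twice: to rescale services by the server speed, and to truncate them. -/
theorem IsMG1Input.map_service {Ω : Type*} [MeasurableSpace Ω] {P : Measure Ω} {r : ℝ}
    {G : Measure ℝ} {A S : ℕ → Ω → ℝ} (h : IsMG1Input P r G A S) {g : ℝ → ℝ} (hg : Measurable g) :
    IsMG1Input P r (G.map g) A fun n ω => g (S n ω) := by
  refine ⟨h.gap_law, fun n => HasLaw.comp ⟨hg.aemeasurable, rfl⟩ (h.service_law n), ?_⟩
  have := h.indep.comp (Sum.elim (fun _ => id) fun _ => g) (by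
    rintro (i | i)
    exacts [measurable_id, hg])
  convert this using 1
  funext s
  cases s <;> rfl

/-! ### Lindley's recursion, independence and stochastic monotonicity -/

theorem fcfsWait_nonneg (t s : ℕ → ℝ) (n : ℕ) : 0 ≤ fcfsWait t s n := by
  cases n with
  | zero => exact le_rfl
  | succ n => exact le_max_left _ _

theorem fcfsWait_mono {t s s' : ℕ → ℝ} (h : ∀ n, s n ≤ s' n) (n : ℕ) :
    fcfsWait t s n ≤ fcfsWait t s' n := by
  induction n with
  | zero => exact le_rfl
  | succ n ih =>
    have := h n
    exact max_le_max le_rfl (by linarith)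

theorem queueWait_succ {Ω : Type*} (A S : ℕ → Ω → ℝ) (n : ℕ) (ω : Ω) :
    queueWait A S (n + 1) ω = max 0 (queueWait A S n ω + S n ω - A (n + 1) ω) := by
  simp only [queueWait, fcfsWait]
  congr 2
  simp only [arrivalEpoch, Finset.sum_range_succ _ (n + 1)]
  ring

/-- The waiting time as a function of all interarrival times and service times. -/
noncomputable def waitOfInput (n : ℕ) (x : ℕ ⊕ ℕ → ℝ) : ℝ :=
  queueWait (fun k (x : ℕ ⊕ ℕ → ℝ) => x (.inl k)) (fun k x => x (.inr k)) n x

theorem waitOfInput_succ (n : ℕ) (x : ℕ ⊕ ℕ → ℝ) :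
    waitOfInput (n + 1) x
      = max 0 (waitOfInput n x + x (.inr n) - x (.inl (n + 1))) :=
  queueWait_succ _ _ _ _

theorem measurable_waitOfInput (n : ℕ) : Measurable (waitOfInput n) := by
  induction n with
  | zero => exact measurable_const
  | succ n ih =>
    rw [funext (waitOfInput_succ n)]
    fun_prop

/-- The waiting time of request `n` depends on gaps up to `n` and services before `n`. -/
theorem waitOfInput_congr (n : ℕ) {x y : ℕ ⊕ ℕ → ℝ} (hg : ∀ k ≤ n, x (.inl k) = y (.inl k))
    (hs : ∀ k < n, x (.inr k) = y (.inr k)) : waitOfInput n x = waitOfInput n y := by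
  induction n with
  | zero => rfl
  | succ n ih =>
    rw [waitOfInput_succ, waitOfInput_succ, hg (n + 1) le_rfl, hs n (by omega),
      ih (fun k hk => hg k (by omega)) fun k hk => hs k (by omega)]

/-- A function depending only on the coordinates in `T` is unchanged when the other coordinates are
set to `0`, hence factors through the restriction to `T`. -/
theorem indepFun_of_dependsOn {Ω ι E F : Type*} [MeasurableSpace Ω] [MeasurableSpace E]
    [MeasurableSpace F] {P : Measure Ω} {X : ι → Ω → ℝ} (h : iIndepFun X P)
    (hX : ∀ i, AEMeasurable (X i) P) {T T' : Finset ι} (hT : Disjoint T T')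
    {φ : (ι → ℝ) → E} {ψ : (ι → ℝ) → F} (hφ : Measurable φ) (hψ : Measurable ψ)
    (hφT : DependsOn φ T) (hψT : DependsOn ψ T') :
    IndepFun (fun ω => φ fun i => X i ω) (fun ω => ψ fun i => X i ω) P := by
  classical
  let e : ∀ T : Finset ι, (T → ℝ) → ι → ℝ := fun T x i => if hi : i ∈ T then x ⟨i, hi⟩ else 0
  have he : ∀ T, Measurable (e T) := fun T => measurable_pi_lambda _ fun i => by
    by_cases hi : i ∈ T
    · simp only [e, dif_pos hi]
      fun_prop
    · simp only [e, dif_neg hi]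
      fun_prop
  have := (h.indepFun_finset₀ T T' hT hX).comp (hφ.comp (he T)) (hψ.comp (he T'))
  convert this using 1
  · funext ω
    exact hφT fun i hi => by simp [e, Finset.mem_coe.1 hi]
  · funext ω
    exact hψT fun i hi => by simp [e, Finset.mem_coe.1 hi]

section

variable {Ω : Type*} [MeasurableSpace Ω] {P : Measure Ω} {r : ℝ} {G : Measure ℝ} {A S : ℕ → Ω → ℝ}

theorem IsMG1Input.aemeasurable (h : IsMG1Input P r G A S) (s : ℕ ⊕ ℕ) :
    AEMeasurable (Sum.elim A S s) P := by
  rcases s with n | n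
  exacts [(h.gap_law n).aemeasurable, (h.service_law n).aemeasurable]

theorem IsMG1Input.aemeasurable_queueWait (h : IsMG1Input P r G A S) (n : ℕ) :
    AEMeasurable (queueWait A S n) P :=
  (measurable_waitOfInput n).comp_aemeasurable (aemeasurable_pi_iff.2 h.aemeasurable)

theorem IsMG1Input.indepFun_wait_service (h : IsMG1Input P r G A S) (n : ℕ) :
    IndepFun (queueWait A S n) (S n) P := by
  classical
  refine indepFun_of_dependsOn h.indep h.aemeasurable
    (T := (Finset.range (n + 1)).disjSum (Finset.range n)) (T' := {.inr n})
    (φ := waitOfInput n) (ψ := fun x => x (.inr n)) ?_ (measurable_waitOfInput n)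
    (measurable_pi_apply _) (fun x y hxy => ?_) fun x y hxy => ?_
  · simp
  · exact waitOfInput_congr n (fun k hk => hxy _ (by simp; omega)) fun k hk => hxy _ (by simp [hk])
  · exact hxy _ (by simp)

theorem IsMG1Input.indepFun_sojourn_gap (h : IsMG1Input P r G A S) (n : ℕ) :
    IndepFun (fun ω => queueWait A S n ω + S n ω) (A (n + 1)) P := by
  classical
  refine indepFun_of_dependsOn h.indep h.aemeasurable
    (T := (Finset.range (n + 1)).disjSum (Finset.range (n + 1))) (T' := {.inl (n + 1)})
    (φ := fun x => waitOfInput n x + x (.inr n)) (ψ := fun x => x (.inl (n + 1))) ?_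
    ((measurable_waitOfInput n).add (measurable_pi_apply _))
    (measurable_pi_apply _) (fun x y hxy => ?_) fun x y hxy => ?_
  · simp
  · exact congrArg₂ _ (waitOfInput_congr n (fun k hk => hxy _ (by simp; omega))
      fun k hk => hxy _ (by simp; omega)) (hxy _ (by simp))
  · exact hxy _ (by simp)

theorem IsMG1Input.hasLaw_wait_service (h : IsMG1Input P r G A S) (n : ℕ) :
    HasLaw (fun ω => (queueWait A S n ω, S n ω)) ((P.map (queueWait A S n)).prod G) P := by
  have := h.indep.isProbabilityMeasure
  exact (indepFun_iff_hasLaw_prodMk_prod ⟨h.aemeasurable_queueWait n, rfl⟩ (h.service_law n)).1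
    (h.indepFun_wait_service n)

theorem IsMG1Input.hasLaw_sojourn_gap (h : IsMG1Input P r G A S) (n : ℕ) :
    HasLaw (fun ω => (queueWait A S n ω + S n ω, A (n + 1) ω))
      ((P.map fun ω => queueWait A S n ω + S n ω).prod (expMeasure r)) P := by
  have := h.indep.isProbabilityMeasure
  exact (indepFun_iff_hasLaw_prodMk_prod
    ⟨(h.aemeasurable_queueWait n).add (h.service_law n).aemeasurable, rfl⟩ (h.gap_law (n + 1))).1
    (h.indepFun_sojourn_gap n)

/-- Waiting times increase stochastically when the queue starts empty. -/
theorem IsMG1Input.lintegral_wait_le_succ (h : IsMG1Input P r G A S) (hr : 0 < r)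
    [IsProbabilityMeasure G] (n : ℕ) {f : ℝ → ENNReal} (hf : Monotone f) :
    ∫⁻ ω, f (queueWait A S n ω) ∂P ≤ ∫⁻ ω, f (queueWait A S (n + 1) ω) ∂P := by
  have := h.indep.isProbabilityMeasure
  have := isProbabilityMeasure_expMeasure hr
  -- By independence each step averages `f` over the same transition kernel, whatever `n` is.
  have hstep : ∀ (n : ℕ) {f : ℝ → ENNReal}, Monotone f →
      ∫⁻ ω, f (queueWait A S (n + 1) ω) ∂P
        = ∫⁻ ω, (∫⁻ s, ∫⁻ a, f (max 0 (queueWait A S n ω + s - a)) ∂expMeasure r ∂G) ∂P := by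
    intro n f hf
    have hfm := hf.measurable
    have hg : Measurable fun v => ∫⁻ a, f (max 0 (v - a)) ∂expMeasure r :=
      Measurable.lintegral_prod_right' (f := fun q : ℝ × ℝ => f (max 0 (q.1 - q.2))) (by fun_prop)
    have hg' : Measurable fun w => ∫⁻ s, ∫⁻ a, f (max 0 (w + s - a)) ∂expMeasure r ∂G :=
      Measurable.lintegral_prod_right'
        (f := fun q : ℝ × ℝ => ∫⁻ a, f (max 0 (q.1 + q.2 - a)) ∂expMeasure r) (by fun_prop)
    have hV : AEMeasurable (fun ω => queueWait A S n ω + S n ω) P :=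
      (h.aemeasurable_queueWait n).add (h.service_law n).aemeasurable
    simp_rw [queueWait_succ]
    rw [(h.hasLaw_sojourn_gap n).lintegral_comp (f := fun q : ℝ × ℝ => f (max 0 (q.1 - q.2)))
      (by fun_prop), lintegral_prod _ (by fun_prop),
      lintegral_map' hg.aemeasurable hV,
      (h.hasLaw_wait_service n).lintegral_comp
        (f := fun q : ℝ × ℝ => ∫⁻ a, f (max 0 (q.1 + q.2 - a)) ∂expMeasure r) (by fun_prop),
      lintegral_prod _ (by fun_prop),
      lintegral_map' hg'.aemeasurable (h.aemeasurable_queueWait n)]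
  induction n generalizing f with
  | zero => exact lintegral_mono fun ω => hf (fcfsWait_nonneg _ _ _)
  | succ n ih =>
    rw [hstep n hf, hstep (n + 1) hf]
    exact ih (f := fun w => ∫⁻ s, ∫⁻ a, f (max 0 (w + s - a)) ∂expMeasure r ∂G)
      fun w w' hw => lintegral_mono fun s => lintegral_mono fun a =>
      hf (max_le_max le_rfl (by linarith))

end

/-! ### Moment recursions for the waiting time -/

theorem MeasureTheory.MemLp.integrable_pow_of_le {Ω : Type*} [MeasurableSpace Ω] {P : Measure Ω}
    [IsFiniteMeasure P] {f : Ω → ℝ} {p k : ℕ} (hf : MemLp f p P) (hk : k ≤ p) :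
    Integrable (fun ω => f ω ^ k) P := by
  have h := (hf.mono_exponent (p := k) (by exact_mod_cast hk)).integrable_norm_pow'
  exact h.mono (hf.aestronglyMeasurable.pow k) (ae_of_all _ fun ω => by simp)

section

variable {Ω : Type*} [MeasurableSpace Ω] {P : Measure Ω} {r : ℝ} {G : Measure ℝ} {A S : ℕ → Ω → ℝ}

theorem IsMG1Input.memLp_service (h : IsMG1Input P r G A S) {p : ENNReal} (hG : MemLp id p G)
    (n : ℕ) : MemLp (S n) p P := by
  rw [← (h.service_law n).map_eq, memLp_map_measure_iff measurable_id.aestronglyMeasurable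
    (h.service_law n).aemeasurable] at hG
  exact hG

theorem IsMG1Input.ae_service_nonneg (h : IsMG1Input P r G A S) (hG0 : ∀ᵐ x ∂G, 0 ≤ x) (n : ℕ) :
    ∀ᵐ ω ∂P, 0 ≤ S n ω := by
  rw [← (h.service_law n).map_eq] at hG0
  exact ae_of_ae_map (h.service_law n).aemeasurable hG0

theorem IsMG1Input.ae_gap_nonneg (h : IsMG1Input P r G A S) (n : ℕ) : ∀ᵐ ω ∂P, 0 ≤ A n ω := by
  have h0 := ae_nonneg_expMeasure r
  rw [← (h.gap_law n).map_eq] at h0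
  exact ae_of_ae_map (h.gap_law n).aemeasurable h0

/-- Gaps are almost surely nonnegative, so each wait is at most the previous wait plus service. -/
theorem IsMG1Input.memLp_wait (h : IsMG1Input P r G A S) (hG0 : ∀ᵐ x ∂G, 0 ≤ x) {p : ENNReal}
    (hG : MemLp id p G) (n : ℕ) : MemLp (queueWait A S n) p P := by
  induction n with
  | zero => exact MemLp.zero (ε := ℝ)
  | succ n ih =>
    refine (ih.add (h.memLp_service hG n)).mono (h.aemeasurable_queueWait _).aestronglyMeasurable ?_
    filter_upwards [h.ae_service_nonneg hG0 n, h.ae_gap_nonneg (n + 1)] with ω hs ha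
    have hw : 0 ≤ queueWait A S n ω := fcfsWait_nonneg _ _ _
    rw [queueWait_succ, Pi.add_apply, Real.norm_of_nonneg (le_max_left _ _),
      Real.norm_of_nonneg (by positivity)]
    exact max_le (by positivity) (by linarith)

/-- The next gap is independent of the sojourn time `V = W n + S n`; conditionally on `V = v` this
is `integral_max_pow_expMeasure`. -/
theorem IsMG1Input.integral_wait_pow_succ (h : IsMG1Input P r G A S) (hr : 0 < r)
    (hG0 : ∀ᵐ x ∂G, 0 ≤ x) {p : ℕ} (hG : MemLp id ((p + 2 : ℕ) : ENNReal) G) (n : ℕ) :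
    ∫ ω, queueWait A S (n + 1) ω ^ (p + 2) ∂P
      = ∫ ω, (queueWait A S n ω + S n ω) ^ (p + 2) ∂P
        - (p + 2) / r * ∫ ω, queueWait A S (n + 1) ω ^ (p + 1) ∂P := by
  have := h.indep.isProbabilityMeasure
  have := isProbabilityMeasure_expMeasure hr
  have hV : AEMeasurable (fun ω => queueWait A S n ω + S n ω) P :=
    (h.aemeasurable_queueWait n).add (h.service_law n).aemeasurable
  set κ := P.map fun ω => queueWait A S n ω + S n ω with hκ
  have : IsProbabilityMeasure κ := Measure.isProbabilityMeasure_map hV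
  have hV0 : ∀ᵐ v ∂κ, 0 ≤ v := by
    rw [hκ, ae_map_iff hV measurableSet_Ici]
    filter_upwards [h.ae_service_nonneg hG0 n] with ω hs
    exact add_nonneg (fcfsWait_nonneg _ _ _) hs
  have hprod : ∀ k ≤ p + 2, Integrable (fun q : ℝ × ℝ => max 0 (q.1 - q.2) ^ k)
      (κ.prod (expMeasure r)) := fun k hk => by
    have hi := (h.memLp_wait hG0 hG (n + 1)).integrable_pow_of_le hk
    simp_rw [queueWait_succ] at hi
    rw [← (h.hasLaw_sojourn_gap n).map_eq, integrable_map_measure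
      (Measurable.aestronglyMeasurable (by fun_prop)) (h.hasLaw_sojourn_gap n).aemeasurable]
    exact hi
  have hmom : ∀ k ≤ p + 2, ∫ ω, queueWait A S (n + 1) ω ^ k ∂P
      = ∫ v, ∫ a, max 0 (v - a) ^ k ∂expMeasure r ∂κ := fun k hk => by
    simp_rw [queueWait_succ]
    rw [← integral_prod _ (hprod k hk)]
    exact (h.hasLaw_sojourn_gap n).integral_comp (f := fun q : ℝ × ℝ => max 0 (q.1 - q.2) ^ k)
      (Measurable.aestronglyMeasurable (by fun_prop))
  have hVint : Integrable (fun v => v ^ (p + 2)) κ := by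
    rw [hκ, integrable_map_measure (Measurable.aestronglyMeasurable (by fun_prop)) hV]
    exact ((h.memLp_wait hG0 hG n).add (h.memLp_service hG n)).integrable_pow_of_le le_rfl
  rw [hmom _ le_rfl, hmom (p + 1) (by omega), integral_congr_ae (hV0.mono fun v hv =>
    integral_max_pow_expMeasure hr hv p), integral_sub hVint
    ((hprod (p + 1) (by omega)).integral_prod_left.const_mul _), integral_const_mul, hκ,
    integral_map hV (Measurable.aestronglyMeasurable (by fun_prop))]

/-- The case `p = 0`, where the cross term of the square factors because `W n` and `S n` are
independent. -/
theorem IsMG1Input.integral_wait_sq_succ (h : IsMG1Input P r G A S) (hr : 0 < r)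
    (hG0 : ∀ᵐ x ∂G, 0 ≤ x) (hG : MemLp id 2 G) (n : ℕ) :
    ∫ ω, queueWait A S (n + 1) ω ^ 2 ∂P
      = ∫ ω, queueWait A S n ω ^ 2 ∂P + 2 * (∫ x, x ∂G) * ∫ ω, queueWait A S n ω ∂P
        + ∫ x, x ^ 2 ∂G - 2 / r * ∫ ω, queueWait A S (n + 1) ω ∂P := by
  have := h.indep.isProbabilityMeasure
  have hG' : MemLp id ((0 + 2 : ℕ) : ENNReal) G := by simpa using hG
  have hrec := h.integral_wait_pow_succ hr hG0 hG' n
  have hW := h.memLp_wait hG0 hG' n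
  have hS := h.memLp_service hG' n
  have hind := h.indepFun_wait_service n
  have hW1 : Integrable (queueWait A S n) P := by
    simpa using hW.integrable_pow_of_le (k := 1) (by norm_num)
  have hS1 : Integrable (S n) P := by simpa using hS.integrable_pow_of_le (k := 1) (by norm_num)
  have hWS : Integrable (fun ω => queueWait A S n ω * S n ω) P := hind.integrable_mul hW1 hS1
  have hexp : ∫ ω, (queueWait A S n ω + S n ω) ^ 2 ∂P
      = ∫ ω, queueWait A S n ω ^ 2 ∂P + 2 * ((∫ ω, queueWait A S n ω ∂P) * ∫ ω, S n ω ∂P)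
        + ∫ ω, S n ω ^ 2 ∂P := by
    have hW2 := hW.integrable_pow_of_le (k := 2) le_rfl
    have hi : Integrable (fun ω => queueWait A S n ω ^ 2 + 2 * (queueWait A S n ω * S n ω)) P :=
      hW2.add (hWS.const_mul 2)
    simp_rw [add_sq, mul_assoc]
    rw [integral_add hi (hS.integrable_pow_of_le le_rfl), integral_add hW2 (hWS.const_mul 2),
      integral_const_mul, ← hind.integral_fun_mul_eq_mul_integral
        hW1.aestronglyMeasurable hS1.aestronglyMeasurable]
  have hm1 : ∫ ω, S n ω ∂P = ∫ x, x ∂G := (h.service_law n).integral_eq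
  have hm2 : ∫ ω, S n ω ^ 2 ∂P = ∫ x, x ^ 2 ∂G :=
    (h.service_law n).integral_comp (f := fun x : ℝ => x ^ 2)
      (Measurable.aestronglyMeasurable (by fun_prop))
  rw [hexp, hm1, hm2] at hrec
  simp only [CharP.cast_eq_zero, zero_add, pow_one] at hrec
  rw [hrec]
  ring

theorem IsMG1Input.integral_wait_cube_succ (h : IsMG1Input P r G A S) (hr : 0 < r)
    (hG0 : ∀ᵐ x ∂G, 0 ≤ x) (hG : MemLp id 3 G) (n : ℕ) :
    ∫ ω, queueWait A S (n + 1) ω ^ 3 ∂P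
      = ∫ ω, queueWait A S n ω ^ 3 ∂P + 3 * (∫ x, x ∂G) * ∫ ω, queueWait A S n ω ^ 2 ∂P
        + 3 * (∫ x, x ^ 2 ∂G) * ∫ ω, queueWait A S n ω ∂P
        + ∫ x, x ^ 3 ∂G - 3 / r * ∫ ω, queueWait A S (n + 1) ω ^ 2 ∂P := by
  have := h.indep.isProbabilityMeasure
  have hG' : MemLp id ((1 + 2 : ℕ) : ENNReal) G := by simpa using hG
  have hrec := h.integral_wait_pow_succ hr hG0 hG' n
  have hW := h.memLp_wait hG0 hG' n
  have hS := h.memLp_service hG' n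
  have hind := h.indepFun_wait_service n
  have hind21 : IndepFun (fun ω => queueWait A S n ω ^ 2) (S n) P :=
    hind.comp (φ := fun x : ℝ => x ^ 2) (ψ := id) (by fun_prop) measurable_id
  have hind12 : IndepFun (queueWait A S n) (fun ω => S n ω ^ 2) P :=
    hind.comp (φ := id) (ψ := fun x : ℝ => x ^ 2) measurable_id (by fun_prop)
  have hW1 : Integrable (queueWait A S n) P := by
    simpa using hW.integrable_pow_of_le (k := 1) (by norm_num)
  have hS1 : Integrable (S n) P := by simpa using hS.integrable_pow_of_le (k := 1) (by norm_num)
  have hW2 := hW.integrable_pow_of_le (k := 2) (by norm_num)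
  have hS2 := hS.integrable_pow_of_le (k := 2) (by norm_num)
  have hW3 := hW.integrable_pow_of_le (k := 3) le_rfl
  have hS3 := hS.integrable_pow_of_le (k := 3) le_rfl
  have hW2S : Integrable (fun ω => queueWait A S n ω ^ 2 * S n ω) P := hind21.integrable_mul hW2 hS1
  have hWS2 : Integrable (fun ω => queueWait A S n ω * S n ω ^ 2) P := hind12.integrable_mul hW1 hS2
  have hexp : ∫ ω, (queueWait A S n ω + S n ω) ^ 3 ∂P
      = ∫ ω, queueWait A S n ω ^ 3 ∂P + 3 * ((∫ ω, queueWait A S n ω ^ 2 ∂P) * ∫ ω, S n ω ∂P)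
        + 3 * ((∫ ω, queueWait A S n ω ∂P) * ∫ ω, S n ω ^ 2 ∂P) + ∫ ω, S n ω ^ 3 ∂P := by
    have hpoly : ∀ ω, (queueWait A S n ω + S n ω) ^ 3 = queueWait A S n ω ^ 3
        + 3 * (queueWait A S n ω ^ 2 * S n ω) + 3 * (queueWait A S n ω * S n ω ^ 2)
        + S n ω ^ 3 := fun ω => by ring
    have hi : Integrable (fun ω => queueWait A S n ω ^ 3 + 3 * (queueWait A S n ω ^ 2 * S n ω)) P :=
      hW3.add (hW2S.const_mul 3)
    have hi' : Integrable (fun ω => queueWait A S n ω ^ 3 + 3 * (queueWait A S n ω ^ 2 * S n ω)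
        + 3 * (queueWait A S n ω * S n ω ^ 2)) P := hi.add (hWS2.const_mul 3)
    simp_rw [hpoly]
    rw [integral_add hi' hS3, integral_add hi (hWS2.const_mul 3),
      integral_add hW3 (hW2S.const_mul 3), integral_const_mul, integral_const_mul,
      ← hind21.integral_fun_mul_eq_mul_integral hW2.aestronglyMeasurable hS1.aestronglyMeasurable,
      ← hind12.integral_fun_mul_eq_mul_integral hW1.aestronglyMeasurable hS2.aestronglyMeasurable]
  have hm1 : ∫ ω, S n ω ∂P = ∫ x, x ∂G := (h.service_law n).integral_eq
  have hm : ∀ k : ℕ, ∫ ω, S n ω ^ k ∂P = ∫ x, x ^ k ∂G := fun k =>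
    (h.service_law n).integral_comp (f := fun x : ℝ => x ^ k)
      (Measurable.aestronglyMeasurable (by fun_prop))
  rw [hexp, hm1, hm, hm] at hrec
  norm_num at hrec
  rw [hrec]
  ring

theorem IsMG1Input.integral_wait_pow_mono (h : IsMG1Input P r G A S) (hr : 0 < r)
    [IsProbabilityMeasure G] (hG0 : ∀ᵐ x ∂G, 0 ≤ x) {k : ℕ} (hG : MemLp id k G) :
    Monotone fun n => ∫ ω, queueWait A S n ω ^ k ∂P := by
  have := h.indep.isProbabilityMeasure
  refine monotone_nat_of_le_succ fun n => ?_
  have hnn : ∀ n ω, 0 ≤ queueWait A S n ω ^ k := fun n ω => pow_nonneg (fcfsWait_nonneg _ _ _) _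
  have hint : ∀ n, Integrable (fun ω => queueWait A S n ω ^ k) P := fun n =>
    (h.memLp_wait hG0 hG n).integrable_pow_of_le le_rfl
  -- Composing with `ENNReal.ofReal` makes the power monotone on all of `ℝ`; on the nonnegative
  -- waits nothing changes.
  have hle := h.lintegral_wait_le_succ hr n
    (f := fun x => ENNReal.ofReal x ^ k) fun x y hxy =>
      pow_le_pow_left' (ENNReal.ofReal_le_ofReal hxy) k
  have hpow : ∀ n ω, ENNReal.ofReal (queueWait A S n ω) ^ k
      = ENNReal.ofReal (queueWait A S n ω ^ k) := fun n ω =>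
    (ENNReal.ofReal_pow (fcfsWait_nonneg _ _ _) k).symm
  simp_rw [hpow] at hle
  rw [← ofReal_integral_eq_lintegral_ofReal (hint n) (ae_of_all _ (hnn n)),
    ← ofReal_integral_eq_lintegral_ofReal (hint (n + 1)) (ae_of_all _ (hnn (n + 1)))] at hle
  exact (ENNReal.ofReal_le_ofReal_iff (integral_nonneg (hnn (n + 1)))).1 hle

end

/-! ### The Pollaczek–Khinchine formula -/

section

variable {Ω : Type*} [MeasurableSpace Ω] {P : Measure Ω} {r : ℝ} {G : Measure ℝ} {A S : ℕ → Ω → ℝ}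

/-- Second moments increase, so the recursion gives `2/r · w (n+1) ≤ 2 m₁ w n + m₂`, where `w` is
the mean wait and `m₁`, `m₂` are the service moments. Replacing `w n` by the larger `w (n+1)` and
solving, which uses stability, gives the bound. -/
theorem IsMG1Input.integral_wait_le (h : IsMG1Input P r G A S) (hr : 0 < r)
    [IsProbabilityMeasure G] (hG0 : ∀ᵐ x ∂G, 0 ≤ x) (hG : MemLp id 2 G)
    (hstab : r * ∫ x, x ∂G < 1) (n : ℕ) :
    ∫ ω, queueWait A S n ω ∂P ≤ r * (∫ x, x ^ 2 ∂G) / (2 * (1 - r * ∫ x, x ∂G)) := by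
  have hw : Monotone fun n => ∫ ω, queueWait A S n ω ∂P := by
    simpa using h.integral_wait_pow_mono hr hG0 (k := 1) (by
      simpa using hG.mono_exponent one_le_two)
  have hq := h.integral_wait_pow_mono hr hG0 (k := 2) hG
  refine (hw n.le_succ).trans ?_
  have h1 := h.integral_wait_sq_succ hr hG0 hG n
  have h2 := hq n.le_succ
  have h3 := hw n.le_succ
  have hm0 : 0 ≤ ∫ x, x ∂G := integral_nonneg_of_ae hG0
  simp only [Nat.succ_eq_add_one] at h2 h3 ⊢
  rw [h1] at h2
  rw [le_div_iff₀ (by linarith)]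
  have h4 := mul_le_mul_of_nonneg_left h3 hm0
  have h5 : 2 / r * ∫ ω, queueWait A S (n + 1) ω ∂P
      ≤ 2 * (∫ x, x ∂G) * (∫ ω, queueWait A S (n + 1) ω ∂P) + ∫ x, x ^ 2 ∂G := by linarith
  have h6 := mul_le_mul_of_nonneg_left h5 hr.le
  have h7 : r * (2 / r * ∫ ω, queueWait A S (n + 1) ω ∂P)
      = 2 * ∫ ω, queueWait A S (n + 1) ω ∂P := by field_simp
  linarith

/-- The third service moment serves only to bound the second moments of the waits. Being monotone,
these then converge and cancel from the limit of the quadratic recursion, leaving a linear equation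
for the limiting mean. -/
theorem IsMG1Input.tendsto_integral_wait_of_memLp_three (h : IsMG1Input P r G A S) (hr : 0 < r)
    [IsProbabilityMeasure G] (hG0 : ∀ᵐ x ∂G, 0 ≤ x) (hG : MemLp id 3 G)
    (hstab : r * ∫ x, x ∂G < 1) :
    Tendsto (fun n => ∫ ω, queueWait A S n ω ∂P) atTop
      (𝓝 (r * (∫ x, x ^ 2 ∂G) / (2 * (1 - r * ∫ x, x ∂G)))) := by
  have hG2 : MemLp id 2 G := hG.mono_exponent (by norm_num)
  have hw : Monotone fun n => ∫ ω, queueWait A S n ω ∂P := by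
    simpa using h.integral_wait_pow_mono hr hG0 (k := 1) (by
      simpa using hG2.mono_exponent one_le_two)
  have hq := h.integral_wait_pow_mono hr hG0 (k := 2) hG2
  have hc := h.integral_wait_pow_mono hr hG0 (k := 3) hG
  have hwle := h.integral_wait_le hr hG0 hG2 hstab
  set b := r * (∫ x, x ^ 2 ∂G) / (2 * (1 - r * ∫ x, x ∂G))
  have hm0 : 0 ≤ ∫ x, x ∂G := integral_nonneg_of_ae hG0
  have hm20 : 0 ≤ ∫ x, x ^ 2 ∂G := integral_nonneg fun x => sq_nonneg x
  have hqle : ∀ n, ∫ ω, queueWait A S n ω ^ 2 ∂P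
      ≤ r * (3 * (∫ x, x ^ 2 ∂G) * b + ∫ x, x ^ 3 ∂G) / (3 * (1 - r * ∫ x, x ∂G)) := fun n => by
    refine (hq n.le_succ).trans ?_
    have h1 := h.integral_wait_cube_succ hr hG0 hG n
    have h2 := hc n.le_succ
    have h3 := hq n.le_succ
    simp only [Nat.succ_eq_add_one] at h2 h3 ⊢
    rw [h1] at h2
    rw [le_div_iff₀ (by linarith)]
    have h4 := mul_le_mul_of_nonneg_left h3 hm0
    have h4' := mul_le_mul_of_nonneg_left (hwle n) hm20
    have h5 : 3 / r * ∫ ω, queueWait A S (n + 1) ω ^ 2 ∂P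
        ≤ 3 * (∫ x, x ∂G) * (∫ ω, queueWait A S (n + 1) ω ^ 2 ∂P)
          + (3 * (∫ x, x ^ 2 ∂G) * b + ∫ x, x ^ 3 ∂G) := by linarith
    have h6 := mul_le_mul_of_nonneg_left h5 hr.le
    have h7 : r * (3 / r * ∫ ω, queueWait A S (n + 1) ω ^ 2 ∂P)
        = 3 * ∫ ω, queueWait A S (n + 1) ω ^ 2 ∂P := by field_simp
    linarith
  have hwlim := tendsto_atTop_ciSup hw ⟨b, by rintro _ ⟨n, rfl⟩; exact hwle n⟩
  have hqlim := tendsto_atTop_ciSup hq ⟨_, by rintro _ ⟨n, rfl⟩; exact hqle n⟩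
  set w := ⨆ n, ∫ ω, queueWait A S n ω ∂P
  set q := ⨆ n, ∫ ω, queueWait A S n ω ^ 2 ∂P
  have hwlim' := (tendsto_add_atTop_iff_nat 1).2 hwlim
  have hqlim' := (tendsto_add_atTop_iff_nat 1).2 hqlim
  have hrhs := ((hqlim.add (hwlim.const_mul (2 * ∫ x, x ∂G))).add_const (∫ x, x ^ 2 ∂G)).sub
    (hwlim'.const_mul (2 / r))
  have heq := tendsto_nhds_unique hqlim' (hrhs.congr fun n =>
    (h.integral_wait_sq_succ hr hG0 hG2 n).symm)
  have hwb : w = r * (∫ x, x ^ 2 ∂G) / (2 * (1 - r * ∫ x, x ∂G)) := by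
    rw [eq_div_iff (by linarith)]
    have h1 : 2 / r * w = 2 * (∫ x, x ∂G) * w + ∫ x, x ^ 2 ∂G := by linarith
    have h2 : r * (2 / r * w) = 2 * w := by field_simp
    rw [h1] at h2
    linarith
  rwa [hwb] at hwlim

/-- The Pollaczek–Khinchine formula for the mean waiting time in an initially empty `M/G/1` queue. -/
theorem IsMG1Input.isSteadyStateMean_wait (h : IsMG1Input P r G A S) (hr : 0 < r)
    [IsProbabilityMeasure G] (hG0 : ∀ᵐ x ∂G, 0 ≤ x) (hG : MemLp id 2 G)
    (hstab : r * ∫ x, x ∂G < 1) :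
    IsSteadyStateMean P (queueWait A S) (r * (∫ x, x ^ 2 ∂G) / (2 * (1 - r * ∫ x, x ∂G))) := by
  have := h.indep.isProbabilityMeasure
  have hint : ∀ n, Integrable (queueWait A S n) P := fun n =>
    (h.memLp_wait hG0 hG n).integrable one_le_two
  have hG1 : Integrable (fun x : ℝ => x) G := hG.integrable one_le_two
  have hG2 : Integrable (fun x : ℝ => x ^ 2) G := hG.integrable_sq
  refine ⟨hint, ?_⟩
  -- Truncated services are bounded and so have a third moment; they keep the queue stable and do
  -- not increase the waits.
  let T : ℕ → ℝ → ℝ := fun K x => min x K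
  have hT : ∀ K, Measurable (T K) := fun K => by fun_prop
  have hTlim : ∀ x, Tendsto (fun K => T K x) atTop (𝓝 x) := fun x => by
    obtain ⟨K, hK⟩ := exists_nat_ge x
    refine tendsto_const_nhds.congr' ?_
    filter_upwards [eventually_ge_atTop K] with L hL
    exact (min_eq_left (hK.trans (by exact_mod_cast hL))).symm
  have hT0 : ∀ K x, 0 ≤ x → 0 ≤ T K x := fun K x hx => le_min hx (Nat.cast_nonneg K)
  have hTle : ∀ K x, T K x ≤ x := fun K x => min_le_left _ _
  have hm1 : Tendsto (fun K => ∫ x, T K x ∂G) atTop (𝓝 (∫ x, x ∂G)) := by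
    refine tendsto_integral_of_dominated_convergence (fun x => x)
      (fun K => (hT K).aestronglyMeasurable) hG1 (fun K => ?_) (ae_of_all _ hTlim)
    filter_upwards [hG0] with x hx
    rw [Real.norm_of_nonneg (hT0 K x hx)]
    exact hTle K x
  have hm2 : Tendsto (fun K => ∫ x, T K x ^ 2 ∂G) atTop (𝓝 (∫ x, x ^ 2 ∂G)) := by
    refine tendsto_integral_of_dominated_convergence (fun x => x ^ 2)
      (fun K => ((hT K).pow_const 2).aestronglyMeasurable) hG2 (fun K => ?_)
      (ae_of_all _ fun x => (hTlim x).pow 2)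
    filter_upwards [hG0] with x hx
    rw [Real.norm_of_nonneg (pow_nonneg (hT0 K x hx) 2)]
    exact pow_le_pow_left₀ (hT0 K x hx) (hTle K x) 2
  have hden : 2 * (1 - r * ∫ x, x ∂G) ≠ 0 := by linarith
  have hlim : Tendsto (fun K => r * (∫ x, T K x ^ 2 ∂G) / (2 * (1 - r * ∫ x, T K x ∂G))) atTop
      (𝓝 (r * (∫ x, x ^ 2 ∂G) / (2 * (1 - r * ∫ x, x ∂G)))) :=
    (hm2.const_mul r).div (((hm1.const_mul r).const_sub 1).const_mul 2) hden
  have htrunc : ∀ K, Tendsto (fun n => ∫ ω, queueWait A (fun n ω => T K (S n ω)) n ω ∂P) atTop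
      (𝓝 (r * (∫ x, T K x ^ 2 ∂G) / (2 * (1 - r * ∫ x, T K x ∂G)))) := fun K => by
    have hGK : IsProbabilityMeasure (G.map (T K)) :=
      Measure.isProbabilityMeasure_map (hT K).aemeasurable
    have hmom : ∀ k : ℕ, ∫ x, x ^ k ∂G.map (T K) = ∫ x, T K x ^ k ∂G := fun k =>
      integral_map (hT K).aemeasurable (Measurable.aestronglyMeasurable (by fun_prop))
    have hmom1 : ∫ x, x ∂G.map (T K) = ∫ x, T K x ∂G := by simpa using hmom 1
    have hK0 : ∀ᵐ x ∂G.map (T K), 0 ≤ x := by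
      rw [ae_map_iff (hT K).aemeasurable measurableSet_Ici]
      exact hG0.mono fun x hx => hT0 K x hx
    have hbd : MemLp id 3 (G.map (T K)) := by
      rw [memLp_map_measure_iff measurable_id.aestronglyMeasurable (hT K).aemeasurable]
      refine MemLp.of_bound (hT K).aestronglyMeasurable K ?_
      filter_upwards [hG0] with x hx
      rw [Function.comp_apply, id, Real.norm_of_nonneg (hT0 K x hx)]
      exact min_le_right _ _
    have hle : ∫ x, T K x ∂G ≤ ∫ x, x ∂G := integral_mono_of_nonneg
      (hG0.mono fun x hx => hT0 K x hx) hG1 (ae_of_all _ (hTle K))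
    have := (h.map_service (hT K)).tendsto_integral_wait_of_memLp_three hr hK0 hbd (by
      rw [hmom1]
      exact (mul_le_mul_of_nonneg_left hle hr.le).trans_lt hstab)
    rwa [hmom, hmom1] at this
  refine tendsto_order.2 ⟨fun a ha => ?_, fun a ha => Eventually.of_forall fun n => ?_⟩
  · obtain ⟨K, hK⟩ := (hlim.eventually (lt_mem_nhds ha)).exists
    filter_upwards [(htrunc K).eventually (lt_mem_nhds hK)] with n hn
    refine hn.trans_le (integral_mono_of_nonneg (ae_of_all _ fun ω => fcfsWait_nonneg _ _ _) (hint n)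
      (ae_of_all _ fun ω => fcfsWait_mono (fun n => hTle K _) n))
  · exact (h.integral_wait_le hr hG0 hG hstab n).trans_lt ha

end

/-! ### Exponential and deterministic services, the aggregate law, and server speed -/

theorem IsMG1Input.isSteadyStateMean_wait_exp {Ω : Type*} [MeasurableSpace Ω] {P : Measure Ω}
    {r μ : ℝ} {A S : ℕ → Ω → ℝ} (h : IsMG1Input P r (expMeasure μ) A S) (hr : 0 < r)
    (hstab : r < μ) : IsSteadyStateMean P (queueWait A S) (r / (μ * (μ - r))) := by
  have hμ : 0 < μ := hr.trans hstab
  have := isProbabilityMeasure_expMeasure hμ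
  have h1 : ∫ x, x ∂expMeasure μ = 1 / μ := by simpa using integral_pow_expMeasure hμ 1
  have h2 : ∫ x, x ^ 2 ∂expMeasure μ = 2 / μ ^ 2 := by simpa using integral_pow_expMeasure hμ 2
  have hpk := h.isSteadyStateMean_wait hr (ae_nonneg_expMeasure μ) (memLp_id_expMeasure hμ) (by
    rw [h1, mul_one_div]
    exact (div_lt_one hμ).2 hstab)
  have hne : μ - r ≠ 0 := by linarith
  convert hpk using 1
  rw [h1, h2]
  have : 1 - r * (1 / μ) = (μ - r) / μ := by field_simp
  rw [this]
  field_simp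

theorem IsMG1Input.isSteadyStateMean_wait_dirac {Ω : Type*} [MeasurableSpace Ω] {P : Measure Ω}
    {r μ : ℝ} {A S : ℕ → Ω → ℝ} (h : IsMG1Input P r (Measure.dirac (1 / μ)) A S) (hr : 0 < r)
    (hstab : r < μ) :
    IsSteadyStateMean P (queueWait A S) (1 / 2 * (1 / (μ - r) - 1 / μ)) := by
  have hμ : 0 < μ := hr.trans hstab
  have hpk := h.isSteadyStateMean_wait hr (by simpa [ae_dirac_eq] using hμ.le)
    ((memLp_two_iff_integrable_sq measurable_id.aestronglyMeasurable).2
      (integrable_dirac enorm_lt_top)) (by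
      rw [integral_dirac, mul_one_div]
      exact (div_lt_one hμ).2 hstab)
  have hne : μ - r ≠ 0 := by linarith
  convert hpk using 1
  rw [integral_dirac, integral_dirac]
  have : 1 - r * (1 / μ) = (μ - r) / μ := by field_simp
  rw [this]
  field_simp
  ring

section aggregate

variable {m : ℕ} {lam : Fin m → ℝ} {law : Fin m → Measure ℝ}

theorem integral_aggregateLaw [NeZero m] (hlam : ∀ i, 0 < lam i) {f : ℝ → ℝ}
    (hf : ∀ i, Integrable f (law i)) :
    ∫ x, f x ∂aggregateLaw lam law = ∑ i, lam i / (∑ j, lam j) * ∫ x, f x ∂law i := by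
  have hpos : 0 < ∑ i, lam i := Finset.sum_pos (fun i _ => hlam i) Finset.univ_nonempty
  rw [aggregateLaw, integral_finsetSum_measure fun i _ =>
    (hf i).smul_measure ENNReal.ofReal_ne_top]
  refine Finset.sum_congr rfl fun i _ => ?_
  rw [integral_smul_measure, ENNReal.toReal_ofReal (div_pos (hlam i) hpos).le, smul_eq_mul]

theorem memLp_two_aggregateLaw (h : ∀ i, MemLp id 2 (law i)) :
    MemLp id 2 (aggregateLaw lam law) := by
  rw [memLp_two_iff_integrable_sq measurable_id.aestronglyMeasurable, aggregateLaw,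
    integrable_finsetSum_measure]
  exact fun i _ => (h i).integrable_sq.smul_measure ENNReal.ofReal_ne_top

theorem ae_nonneg_aggregateLaw (h : ∀ i, ∀ᵐ x ∂law i, 0 ≤ x) :
    ∀ᵐ x ∂aggregateLaw lam law, 0 ≤ x := by
  rw [ae_iff, aggregateLaw, Measure.coe_finsetSum, Finset.sum_apply]
  refine Finset.sum_eq_zero fun i _ => ?_
  rw [Measure.smul_apply, ae_iff.1 (h i), smul_zero]

end aggregate

/-- The Pollaczek–Khinchine formula in terms of the service rate and the variance of the service
times, for a server of speed `k`. -/
theorem IsMG1Input.isSteadyStateMean_wait_div {Ω : Type*} [MeasurableSpace Ω] {P : Measure Ω}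
    {r : ℝ} {G : Measure ℝ} [IsProbabilityMeasure G] {A S : ℕ → Ω → ℝ} (h : IsMG1Input P r G A S)
    (hr : 0 < r) (hG0 : ∀ᵐ x ∂G, 0 ≤ x) (hG : MemLp id 2 G) {k μ : ℝ} (hk : 0 < k)
    (hμ : ∫ x, x ∂G = 1 / μ) (hμ0 : 0 < μ) (hstab : r < k * μ) :
    IsSteadyStateMean P (queueWait A fun n ω => S n ω / k)
      ((r / (k * μ) + r * (k * μ) * Var[fun x => x / k; G]) / (2 * (k * μ - r))) := by
  have hdiv : Measurable fun x : ℝ => x / k := by fun_prop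
  have hGk : IsProbabilityMeasure (G.map fun x => x / k) :=
    Measure.isProbabilityMeasure_map hdiv.aemeasurable
  have hm1 : ∫ x, x ∂G.map (fun x => x / k) = 1 / (k * μ) := by
    rw [integral_map hdiv.aemeasurable (Measurable.aestronglyMeasurable (by fun_prop)),
      integral_div, hμ]
    field_simp
  have hm2 : ∫ x, x ^ 2 ∂G.map (fun x => x / k)
      = Var[fun x => x / k; G] + (1 / (k * μ)) ^ 2 := by
    rw [integral_map hdiv.aemeasurable (Measurable.aestronglyMeasurable (by fun_prop)),
      variance_eq_sub (by simpa [div_eq_mul_inv] using! hG.mul_const k⁻¹), integral_div, hμ]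
    simp only [Pi.pow_apply]
    field_simp
    ring
  have hkμ : 0 < k * μ := mul_pos hk hμ0
  have hpk := (h.map_service hdiv).isSteadyStateMean_wait hr
    (by
      rw [ae_map_iff hdiv.aemeasurable measurableSet_Ici]
      exact hG0.mono fun x hx => div_nonneg hx hk.le)
    (by
      rw [memLp_map_measure_iff measurable_id.aestronglyMeasurable hdiv.aemeasurable]
      simpa [div_eq_mul_inv] using! hG.mul_const k⁻¹)
    (by
      rw [hm1, mul_one_div]
      exact (div_lt_one hkμ).2 hstab)
  have hne : k * μ - r ≠ 0 := by linarith
  convert hpk using 1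
  rw [hm1, hm2]
  have : 1 - r * (1 / (k * μ)) = (k * μ - r) / (k * μ) := by field_simp
  rw [this]
  field_simp
  ring

/-! ### Comparison of the end-to-end latencies -/

theorem lemma2 {Ω : Type*} [MeasurableSpace Ω] (P : Measure Ω) [IsProbabilityMeasure P]
    (m : ℕ) [NeZero m]
    -- request rates of the devices, and service time distributions of their requests at the edge
    (lam : Fin m → ℝ) (hlam : ∀ i, 0 < lam i)
    (law : Fin m → Measure ℝ) [∀ i, IsProbabilityMeasure (law i)]
    (hlaw_nonneg : ∀ i, ∀ᵐ x ∂law i, 0 ≤ x) (hlaw_sq : ∀ i, MemLp id 2 (law i))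
    -- the device that chooses between on-device processing and offloading
    (dev : Fin m) (lamDev : ℝ) (hlamDev : lamDev = lam dev)
    (lamEdge : ℝ) (hlamEdge : lamEdge = ∑ i, lam i)
    -- mean service times, service rates, degrees of parallelism
    (sDev sEdge muDev muEdge kDev kEdge : ℝ)
    (hsDev : 0 < sDev) (hmuDev : muDev = 1 / sDev)
    (hsEdge : sEdge = ∑ i, lam i / lamEdge * ∫ x, x ∂law i)
    (hsEdge_pos : 0 < sEdge) (hmuEdge : muEdge = 1 / sEdge)
    (hkDev : 0 < kDev) (hkEdge : 0 < kEdge)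
    -- utilization of the edge, and variance of its service times, both at aggregated service rate
    (rhoEdge varEdge : ℝ) (hrhoEdge : rhoEdge = lamEdge / (kEdge * muEdge))
    (hvarEdge : varEdge = Var[fun x => x / kEdge; aggregateLaw lam law])
    -- network parameters
    (muDevNet muEdgeNet Dreq Dres B : ℝ) (hDreq : 0 ≤ Dreq) (hDres : 0 ≤ Dres) (hB : 0 < B)
    -- stability of the four queues
    (hstabDevNet : lamDev < muDevNet) (hstabEdgeNet : lamEdge < muEdgeNet)
    (hstabEdge : lamEdge < kEdge * muEdge) (hstabDev : lamDev < kDev * muDev)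
    -- `M/M/1` queues at the network interfaces of the device and of the edge
    (ADevNet SDevNet AEdgeNet SEdgeNet : ℕ → Ω → ℝ)
    (hDevNet : IsMG1Input P lamDev (expMeasure muDevNet) ADevNet SDevNet)
    (hEdgeNet : IsMG1Input P lamEdge (expMeasure muEdgeNet) AEdgeNet SEdgeNet)
    -- `M/D/1` queue at the processor of the device
    (ADev SDev : ℕ → Ω → ℝ)
    (hDev : IsMG1Input P lamDev (Measure.dirac (1 / (kDev * muDev))) ADev SDev)
    -- queue at the processor of the edge, fed by the requests of all devices
    (AEdge SEdge : Fin m → ℕ → Ω → ℝ) (hEdge : IsTenantInput P lam law AEdge SEdge) :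
    IsMG1Input P lamEdge (aggregateLaw lam law) (sharedGap AEdge) (sharedService AEdge SEdge) ∧
    ∃ wDevNet wEdgeNet wDevProc wEdgeProc TDev TEdge : ℝ,
      IsSteadyStateMean P (queueWait ADevNet SDevNet) wDevNet ∧
      IsSteadyStateMean P (queueWait AEdgeNet SEdgeNet) wEdgeNet ∧
      IsSteadyStateMean P (queueWait ADev SDev) wDevProc ∧
      IsSteadyStateMean P (sharedWait kEdge AEdge SEdge) wEdgeProc ∧
      IsSteadyStateMean P (sharedService AEdge SEdge) sEdge ∧
      TDev = wDevProc + sDev ∧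
      TEdge = wDevNet + Dreq / B + wEdgeProc + sEdge + wEdgeNet + Dres / B ∧
      (TDev < TEdge ↔
        sDev - sEdge <
          lamDev / (muDevNet * (muDevNet - lamDev))
          + lamEdge / (muEdgeNet * (muEdgeNet - lamEdge))
          + (Dreq + Dres) / B
          + (rhoEdge + lamEdge * (kEdge * muEdge) * varEdge) / (2 * (kEdge * muEdge - lamEdge))
          - 1 / 2 * (1 / (kDev * muDev - lamDev) - 1 / (kDev * muDev))) := by
  subst hlamDev hlamEdge hrhoEdge hvarEdge
  have hpos : 0 < ∑ i, lam i := Finset.sum_pos (fun i _ => hlam i) Finset.univ_nonempty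
  have := isProbabilityMeasure_aggregateLaw hlam law
  have hinput := hEdge.isMG1Input_shared hlam
  have hlaw1 : ∀ i, Integrable (fun x : ℝ => x) (law i) := fun i =>
    (hlaw_sq i).integrable one_le_two
  have hmean : ∫ x, x ∂aggregateLaw lam law = sEdge := by
    rw [integral_aggregateLaw hlam hlaw1, hsEdge]
  have hG := memLp_two_aggregateLaw (lam := lam) hlaw_sq
  have hmu0 : 0 < muEdge := by
    rw [hmuEdge]
    positivity
  have hwEdge := hinput.isSteadyStateMean_wait_div hpos (ae_nonneg_aggregateLaw hlaw_nonneg) hG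
    hkEdge (μ := muEdge) (by rw [hmean, hmuEdge, one_div_one_div]) hmu0 hstabEdge
  rw [← sharedWait_eq_queueWait] at hwEdge
  have hservice : IsSteadyStateMean P (sharedService AEdge SEdge) sEdge := by
    refine ⟨fun n => (hinput.memLp_service hG n).integrable one_le_two, ?_⟩
    simp_rw [fun n => (hinput.service_law n).integral_eq, hmean]
    exact tendsto_const_nhds
  refine ⟨hinput, _, _, _, _, _, _, hDevNet.isSteadyStateMean_wait_exp (hlam dev) hstabDevNet,
    hEdgeNet.isSteadyStateMean_wait_exp hpos hstabEdgeNet,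
    hDev.isSteadyStateMean_wait_dirac (hlam dev) hstabDev, hwEdge, hservice, rfl, rfl, ?_⟩
  -- With the network term split, both inequalities are linear in the same fractions and differ only
  -- by moving terms across.
  rw [add_div Dreq]
  constructor <;> intro h <;> linarith
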